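/- Let $\lambda$ be a Young diagram with $|\lambda|=n$, let $\rho=(\rho_1,\dots,\rho_k)$ be a sequence of positive integers with $\rho_1+\dots+\rho_k=n$, and let $\chi^\lambda_\rho$ be the value of the irreducible character $\chi^\lambda$ of the symmetric group $S_n$ (the character of the Specht module of shape $\lambda$) at any permutation with $k$ cycles of lengths $\rho_1,\dots,\rho_k$. Let $p_1>\dots>p_d\ge 0$ and $q_1>\dots>q_d\ge 0$ be the Frobenius coordinates of $\lambda$: $d$ is the number of diagonal cells of $\lambda$, and $p_i$ (resp. $q_i$) is the number of cells of $\lambda$ to the right of (resp. below) the $i$-th diagonal cell. A filled block is either a hook block, carrying a pair $(p,q)$ of nonnegative integers (its $p$- and $q$-number) and having cardinality $p+q+1$, or a linear horizontal block or a linear vertical block, carrying a positive integer (its filling number), which is also its cardinality. A filled structure $T$ with $k$ blocks is a sequence of filled blocks numbered $1,\dots,k$ together with a partition of the set of these blocks into nonempty subsets, called fragments, such that each fragment contains exactly one hook block and this hook block precedes all other blocks of the fragment. The cardinality of $T$ is the sequence of the cardinalities of its blocks $1,\dots,k$. The $P$-number of a fragment is the $p$-number of its hook block plus the sum of the filling numbers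 of its horizontal blocks; the $Q$-number of a fragment is the $q$-number of its hook block plus the sum of the filling numbers of its vertical blocks. If $(P_1,Q_1),\dots,(P_d,Q_d)$ are the $P$- and $Q$-numbers of the fragments of $T$ (numbered arbitrarily) and $\upsilon(T)$ is the number of vertical blocks of $T$, put $$\operatorname{sgn}T=\operatorname{sgn}\Bigl(\prod_{i<j}(P_i-P_j)(Q_i-Q_j)\Bigr)\,(-1)^{\sum_j Q_j+\upsilon(T)}\in\{-1,0,1\}.$$ Then $$\chi^\lambda_\rho=\sum_T\operatorname{sgn}T,$$ where the sum is over all filled structures $T$ of cardinality $\rho$ whose fragments' $P$-numbers and $Q$-numbers coincide, each up to a permutation, with the Frobenius coordinates $(p_1,\dots,p_d)$ and $(q_1,\dots,q_d)$ of $\lambda$, respectively. -/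

import Mathlib

/-! ### The irreducible characters of the symmetric group -/

namespace SpechtChar

open Equiv

/-- The row group of a bijective tableau `t` of shape `μ`: permutations preserving every row. -/
def rowGroup {n : ℕ} {μ : YoungDiagram} (t : {c // c ∈ μ.cells} ≃ Fin n) :
    Finset (Perm (Fin n)) :=
  Finset.univ.filter fun σ => ∀ x, (t.symm (σ x)).1.1 = (t.symm x).1.1

/-- The column group of a bijective tableau `t` of shape `μ`: permutations preserving every
column. -/
def colGroup {n : ℕ} {μ : YoungDiagram} (t : {c // c ∈ μ.cells} ≃ Fin n) :
    Finset (Perm (Fin n)) :=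
  Finset.univ.filter fun σ => ∀ x, (t.symm (σ x)).1.2 = (t.symm x).1.2

/-- The Young symmetrizer `(∑_{p ∈ row group} p) (∑_{q ∈ column group} sgn(q) q)` in `ℂ[S_n]`. -/
noncomputable def youngSymmetrizer {n : ℕ} {μ : YoungDiagram}
    (t : {c // c ∈ μ.cells} ≃ Fin n) : MonoidAlgebra ℂ (Perm (Fin n)) :=
  (∑ p ∈ rowGroup t, MonoidAlgebra.single p (1 : ℂ)) *
    ∑ q ∈ colGroup t, MonoidAlgebra.single q (((Perm.sign q : ℤˣ) : ℤ) : ℂ)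

/-- The irreducible `S_n`-module attached to `μ` (the Specht module), realized as the left ideal
of `ℂ[S_n]` generated by the Young symmetrizer. -/
noncomputable def spechtModule {n : ℕ} {μ : YoungDiagram} (t : {c // c ∈ μ.cells} ≃ Fin n) :
    Ideal (MonoidAlgebra ℂ (Perm (Fin n))) :=
  Ideal.span {youngSymmetrizer t}

/-- The character `χ^μ` of `S_n`, afforded by the action of `S_n` on the Specht module by left
multiplication. -/
noncomputable def irrCharacter {n : ℕ} {μ : YoungDiagram} (t : {c // c ∈ μ.cells} ≃ Fin n)
    (g : Perm (Fin n)) : ℂ :=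
  (Representation.ofModule' (k := ℂ) (G := Perm (Fin n)) (spechtModule t)).character g

end SpechtChar

/-! ### Frobenius coordinates -/

namespace FrobeniusCoord

/-- The (0-based) indices `i` such that the diagonal cell `(i, i)` lies in `μ`. -/
def diagonal (μ : YoungDiagram) : Finset ℕ :=
  (Finset.range μ.card).filter fun i => (i, i) ∈ μ

/-- The Frobenius `p`-coordinates: for each diagonal cell, the number of cells to its right. -/
def pCoords (μ : YoungDiagram) : Multiset ℕ :=
  (diagonal μ).val.map fun i => μ.rowLen i - (i + 1)

/-- The Frobenius `q`-coordinates: for each diagonal cell, the number of cells below it. -/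
def qCoords (μ : YoungDiagram) : Multiset ℕ :=
  (diagonal μ).val.map fun i => μ.colLen i - (i + 1)

end FrobeniusCoord

/-! ### Filled structures -/

/-- A filled block: a hook block with its filling `p`- and `q`-numbers, or a linear horizontal or
linear vertical block with its (positive) filling number. -/
inductive FilledBlock : Type
  | hook (p q : ℕ)
  | horizontal (m : ℕ+)
  | vertical (m : ℕ+)

namespace FilledBlock

/-- The cardinality of a block. -/
def card : FilledBlock → ℕ
  | hook p q => p + q + 1
  | horizontal m => m
  | vertical m => m

/-- The contribution of a block to the filling `p`-number of its fragment. -/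
def pNum : FilledBlock → ℕ
  | hook p _ => p
  | horizontal m => m
  | vertical _ => 0

/-- The contribution of a block to the filling `q`-number of its fragment. -/
def qNum : FilledBlock → ℕ
  | hook _ q => q
  | horizontal _ => 0
  | vertical m => m

/-- Being a hook block. -/
def isHook : FilledBlock → Bool
  | hook _ _ => true
  | _ => false

/-- Being a linear vertical block. -/
def isVertical : FilledBlock → Bool
  | vertical _ => true
  | _ => false

end FilledBlock

/-- A filled structure with `k` blocks. The blocks are numbered by `Fin k` according to the linear
ordering of all blocks; the fragments partition the blocks; every fragment has exactly one hook
block, and it precedes all other blocks of the fragment. The partial order inside a fragment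
(the hook first, the horizontal blocks linearly ordered, the vertical blocks linearly ordered, no
other relations) is compatible with the linear ordering of all blocks, so it is determined by
these data and is not recorded separately. -/
structure FilledStructure (k : ℕ) where
  /-- The filled blocks, in their linear order. -/
  block : Fin k → FilledBlock
  /-- The partition of the blocks into fragments. -/
  fragments : Finpartition (Finset.univ : Finset (Fin k))
  /-- Each fragment has a hook block that precedes all its other blocks, which are linear. -/
  exists_hook : ∀ F ∈ fragments.parts, ∃ i ∈ F, (block i).isHook = true ∧
    ∀ j ∈ F, j ≠ i → (block j).isHook = false ∧ i < j

namespace FilledStructure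

variable {k : ℕ} (T : FilledStructure k)

/-- The cardinality of a filled structure: the ordered list of the cardinalities of its blocks. -/
def cardinality : Fin k → ℕ := fun i => (T.block i).card

/-- The filling `p`-number of a fragment. -/
def fragP (F : Finset (Fin k)) : ℕ := ∑ i ∈ F, (T.block i).pNum

/-- The filling `q`-number of a fragment. -/
def fragQ (F : Finset (Fin k)) : ℕ := ∑ i ∈ F, (T.block i).qNum

/-- The multiset `{P_1, …, P_d}` of the filling `p`-numbers of the fragments. -/
def pNumbers : Multiset ℕ := T.fragments.parts.val.map T.fragP

/-- The multiset `{Q_1, …, Q_d}` of the filling `q`-numbers of the fragments. -/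
def qNumbers : Multiset ℕ := T.fragments.parts.val.map T.fragQ

/-- The number of linear vertical blocks. -/
def numVertical : ℕ := (Finset.univ.filter fun i => (T.block i).isVertical = true).card

/-- The hook blocks; each fragment contains exactly one of them. -/
def hooks : Finset (Fin k) := Finset.univ.filter fun i => (T.block i).isHook = true

/-- The product `∏_{i<j} (P_i - P_j) (Q_i - Q_j)` over the pairs of fragments, where the fragments
are numbered in the order of their hook blocks (the product does not depend on the numbering). -/
def vandermonde : ℤ :=
  ∏ i ∈ T.hooks, ∏ j ∈ T.hooks.filter (fun j => i < j),
    (((T.fragP (T.fragments.part i) : ℤ) - T.fragP (T.fragments.part j)) *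
      ((T.fragQ (T.fragments.part i) : ℤ) - T.fragQ (T.fragments.part j)))

/-- The sign of a filled structure, an element of `{-1, 0, 1}`. -/
def sgn : ℤ :=
  T.vandermonde.sign * (-1) ^ ((∑ F ∈ T.fragments.parts, T.fragQ F) + T.numVertical)

end FilledStructure

theorem FilledBlock.finite_card_eq (m : ℕ) : {b : FilledBlock | b.card = m}.Finite := by
  have h1 : ((Set.Iic m ×ˢ Set.Iic m : Set (ℕ × ℕ))).Finite :=
    (Set.finite_Iic m).prod (Set.finite_Iic m)
  have h2 : {a : ℕ+ | (a : ℕ) = m}.Finite :=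
    Set.Subsingleton.finite fun a ha b hb => PNat.eq (ha.trans hb.symm)
  refine (((h1.image fun x => FilledBlock.hook x.1 x.2).union
    (h2.image FilledBlock.horizontal)).union (h2.image FilledBlock.vertical)).subset ?_
  rintro (⟨p, q⟩ | a | a) h
  · refine Or.inl (Or.inl ⟨(p, q), ?_, rfl⟩)
    simp only [Set.mem_ofPred_eq, FilledBlock.card] at h
    simp only [Set.mem_prod, Set.mem_Iic]
    omega
  · exact Or.inl (Or.inr ⟨a, h, rfl⟩)
  · exact Or.inr ⟨a, h, rfl⟩

theorem FilledStructure.finite_cardinality_eq {k : ℕ} (ρ : Fin k → ℕ) :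
    {T : FilledStructure k | T.cardinality = ρ}.Finite := by
  have h1 : (Set.univ.pi fun i => {b : FilledBlock | b.card = ρ i}).Finite :=
    Set.Finite.pi fun i => FilledBlock.finite_card_eq (ρ i)
  refine Set.Finite.of_finite_image ((h1.prod (Set.finite_univ
    (α := Finpartition (Finset.univ : Finset (Fin k))))).subset ?_)
    (f := fun T => (T.block, T.fragments)) ?_
  · rintro _ ⟨T, hT, rfl⟩
    exact ⟨fun i _ => congrFun hT i, Set.mem_univ _⟩
  · rintro ⟨b, F, h⟩ _ ⟨b', F', h'⟩ _ he
    simp only [Prod.mk.injEq] at he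
    obtain ⟨rfl, rfl⟩ := he
    rfl

/-- The finite set of the filled structures of cardinality `ρ` such that the filling `p`- and
`q`-numbers of the fragments are, each up to a permutation, the Frobenius coordinates of `μ`. -/
noncomputable def filledStructures {k : ℕ} (μ : YoungDiagram) (ρ : Fin k → ℕ) :
    Finset (FilledStructure k) :=
  (FilledStructure.finite_cardinality_eq ρ).toFinset.filter fun T =>
    T.pNumbers = FrobeniusCoord.pCoords μ ∧ T.qNumbers = FrobeniusCoord.qCoords μ

/-! ### Zero-one matrices dominated by a Young diagram -/

namespace YoungDiagram

open Finset

/-! Both sides are compared with the Jacobi–Trudi sum `J = jacobiTrudi μ`, the expansion of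
`det(h_{μ_i - i + j})` as a signed combination, over `w`, of the permutation characters on
colourings with content `μ_i - i + w i`.

The Specht character `χ` equals `J` by a norm argument: `∑ χ²`, `∑ J χ` and `∑ J²` over `S_n` are
all `n!`, and both functions are real, so `∑ (χ - J)² = 0`. The first sum comes from the
quasi-idempotence of the Young symmetrizer. The other two rest on one fact: every content in `J`
dominates `μ`, and two jointly injective colourings dominating `μ` and its transpose must enumerate
the cells of `μ`, so only the terms with trivial `w` survive (`HasContent.image_eq_cells`). The
third sum is reached as `∑ sgn · J_μ · J_μ'`, which requires `J_μ' = sgn · J_μ`; this symmetry is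
read off from the filled structures, by transposing all blocks.

`J` equals the sum of signs by a fermionic computation. A colouring fixed by `g` assigns the cycle
lengths `ρ_i` as steps to `n` particles that start in the vacuum positions `n - 1, …, 0`; `J` sums
over these assignments the antisymmetrized indicator of the positions `μ_i + n - 1 - i`. A step of
length `m` is the operator `raise`. Commuted past an excitation `(p, q)`, it yields `(p + m, q)`
with sign plus and `(p, q + m)` with sign minus, that is, a horizontal or a vertical block; on the
vacuum itself it creates the excitations with `p + q + 1 = m`, that is, the hook blocks
(`state_raise`, `sum_load_eq_sum_codes`). The excited configuration is that of `μ` exactly when its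
heights and depths are the Frobenius coordinates, and the sign of the permutation sorting it is the
sign in the formula (`state_eq_zero_or_exists`, `state_antisymm`). -/

theorem card_filter_cells_box (μ : YoungDiagram) {i c : ℕ} (h : c ≤ μ.rowLen i) :
    #{x ∈ μ.cells | x.1 < i + 1 ∧ x.2 < c} = (i + 1) * c := by
  have : {x ∈ μ.cells | x.1 < i + 1 ∧ x.2 < c} = range (i + 1) ×ˢ range c := by
    ext ⟨a, b⟩
    simp only [mem_filter, mem_cells, mem_product, mem_range, and_iff_right_iff_imp, and_imp]
    intro ha hb
    exact mem_iff_lt_rowLen.2 (by have := μ.rowLen_anti a i (by omega); omega)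
  rw [this, card_product, card_range, card_range]

/-- A jointly injective pair of functions whose initial counts dominate the row and the column
counts of a Young diagram of the same size enumerates the cells of the diagram. -/
theorem image_eq_cells {X : Type*} [Fintype X] (μ : YoungDiagram) (r c : X → ℕ)
    (hinj : Function.Injective fun x => (r x, c x)) (hcard : Fintype.card X = μ.card)
    (hr : ∀ i, #{x ∈ μ.cells | x.1 < i} ≤ #{x : X | r x < i})
    (hc : ∀ i, #{x ∈ μ.cells | x.2 < i} ≤ #{x : X | c x < i}) :
    univ.image (fun x => (r x, c x)) = μ.cells := by
  symm
  apply eq_of_subset_of_card_le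
  swap
  · rw [card_image_of_injective _ hinj, card_univ, hcard]
  rintro ⟨i, j⟩ hij
  rw [mem_cells] at hij
  -- The corner of the box is chosen so that every cell to the right of column `l` lies above row
  -- `i`. The two domination hypotheses then force at least `(i + 1) * l` points into the box, and
  -- joint injectivity makes them fill it, the cell `(i, j)` included.
  set l := μ.rowLen i with hl
  have hj : j < l := mem_iff_lt_rowLen.1 hij
  have h1 : #{x ∈ μ.cells | x.1 < i + 1} =
      (i + 1) * l + #{x ∈ μ.cells | ¬ x.2 < l} := by
    rw [← card_filter_cells_box μ (le_refl (μ.rowLen i)),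
      ← card_filter_add_card_filter_not (s := {x ∈ μ.cells | x.1 < i + 1}) (fun x => x.2 < l),
      filter_filter, filter_filter]
    congr 2
    ext ⟨a, b⟩
    simp only [mem_filter, mem_cells, and_congr_right_iff, and_iff_right_iff_imp]
    intro hab hb
    by_contra ha
    have := mem_iff_lt_rowLen.1 hab
    have := μ.rowLen_anti i a (by omega)
    omega
  have h2 : #{x : X | r x < i + 1} ≤ #{x : X | r x < i + 1 ∧ c x < l} + #{x : X | ¬ c x < l} := by
    rw [← card_filter_add_card_filter_not (s := {x : X | r x < i + 1}) (fun x => c x < l),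
      filter_filter, filter_filter]
    gcongr
    exact fun h => h.2
  have h3 := card_filter_add_card_filter_not (s := (univ : Finset X)) (fun x => c x < l)
  have h4 := card_filter_add_card_filter_not (s := μ.cells) (fun x => x.2 < l)
  have h5 := hr (i + 1)
  have h6 := hc l
  rw [card_univ, hcard] at h3
  change _ = μ.card at h4
  have h7 : (i + 1) * l ≤ #{x : X | r x < i + 1 ∧ c x < l} := by omega
  have h8 : ({x : X | r x < i + 1 ∧ c x < l} : Finset X).image (fun x => (r x, c x)) =
      range (i + 1) ×ˢ range l := by
    apply eq_of_subset_of_card_le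
    · intro y hy
      simp only [mem_image, mem_filter, mem_univ, true_and] at hy
      obtain ⟨x, hx, rfl⟩ := hy
      simpa using hx
    · rw [card_image_of_injective _ hinj, card_product, card_range, card_range]
      exact h7
  have h9 : (i, j) ∈ range (i + 1) ×ˢ range l := by simp [hj]
  rw [← h8] at h9
  exact image_subset_image (filter_subset _ _) h9

theorem card_filter_fst_eq (μ : YoungDiagram) (i : ℕ) :
    #{x ∈ μ.cells | x.1 = i} = μ.rowLen i := (μ.rowLen_eq_card).symm

theorem card_filter_snd_eq (μ : YoungDiagram) (i : ℕ) :
    #{x ∈ μ.cells | x.2 = i} = μ.colLen i := (μ.colLen_eq_card).symm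

theorem card_filter_of_image_eq_cells {X : Type*} [Fintype X] {μ : YoungDiagram} {r c : X → ℕ}
    (hinj : Function.Injective fun x => (r x, c x))
    (h : univ.image (fun x => (r x, c x)) = μ.cells) (P : ℕ × ℕ → Prop) [DecidablePred P] :
    #{x : X | P (r x, c x)} = #{x ∈ μ.cells | P x} := by
  rw [← h, filter_image, card_image_of_injective _ hinj]

theorem card_transpose (μ : YoungDiagram) : μ.transpose.card = μ.card := by
  have : μ.transpose.cells = μ.cells.map (Equiv.prodComm ℕ ℕ).toEmbedding := by
    ext ⟨a, b⟩
    simp [mem_transpose]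
  rw [YoungDiagram.card, this, card_map]

theorem card_filter_transpose_cells (μ : YoungDiagram) (P : ℕ → Prop) [DecidablePred P] :
    #{x ∈ μ.transpose.cells | P x.1} = #{x ∈ μ.cells | P x.2} := by
  have : μ.transpose.cells = μ.cells.map (Equiv.prodComm ℕ ℕ).toEmbedding := by
    ext ⟨a, b⟩
    simp [mem_transpose]
  rw [this, filter_map, card_map]
  rfl

theorem lt_card_of_mem {μ : YoungDiagram} {x : ℕ × ℕ} (hx : x ∈ μ) :
    x.1 < μ.card ∧ x.2 < μ.card := by
  obtain ⟨i, j⟩ := x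
  constructor
  · calc i < μ.colLen j := mem_iff_lt_colLen.1 hx
      _ ≤ μ.card := by rw [colLen_eq_card]; exact card_filter_le _ _
  · calc j < μ.rowLen i := mem_iff_lt_rowLen.1 hx
      _ ≤ μ.card := by rw [rowLen_eq_card]; exact card_filter_le _ _

/-- The Jacobi–Trudi content condition for the summand indexed by `w`: the colour `i` is used
`μ_i - i + w i` times. -/
def HasContent {n : ℕ} (μ : YoungDiagram) (w : Equiv.Perm (Fin n)) (f : Fin n → Fin n) : Prop :=
  ∀ i, #{x | f x = i} + (i : ℕ) = μ.rowLen i + w i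

instance {n : ℕ} (μ : YoungDiagram) (w : Equiv.Perm (Fin n)) :
    DecidablePred (μ.HasContent w) := fun f => by
  unfold HasContent
  infer_instance

/-- An initial segment has the least sum among the sets of its size: the elements exchanged out are
below `r`, those exchanged in are at least `r`, and there are equally many. -/
theorem sum_range_le_sum_perm {n : ℕ} (w : Equiv.Perm (Fin n)) (r : ℕ) :
    ∑ i : Fin n with i.val < r, (i : ℕ) ≤ ∑ i : Fin n with i.val < r, (w i : ℕ) := by
  set S : Finset (Fin n) := {i : Fin n | (i : ℕ) < r} with hS
  have key : ∑ i ∈ S, (i : ℕ) ≤ ∑ i ∈ S.map w.toEmbedding, (i : ℕ) := by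
    set T := S.map w.toEmbedding
    have hc : #(S \ T) = #(T \ S) := by
      have h1 := card_sdiff_add_card_inter S T
      have h2 := card_sdiff_add_card_inter T S
      rw [inter_comm] at h2
      have : #T = #S := card_map _
      omega
    rw [← sum_inter_add_sum_sdiff S T, ← sum_inter_add_sum_sdiff T S, inter_comm T S]
    refine Nat.add_le_add_left ?_ _
    calc ∑ i ∈ S \ T, (i : ℕ) ≤ ∑ i ∈ S \ T, r := sum_le_sum fun i hi => by
          simp only [hS, mem_sdiff, mem_filter] at hi; omega
      _ = ∑ i ∈ T \ S, r := by simp [hc]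
      _ ≤ _ := sum_le_sum fun i hi => by
          simp only [hS, mem_sdiff, mem_filter, mem_univ, true_and] at hi; omega
  simpa using key

theorem card_filter_lt_eq_sum {X : Type*} [Fintype X] {n : ℕ} (f : X → Fin n) (r : ℕ) :
    #{x | (f x : ℕ) < r} = ∑ i : Fin n with i.val < r, #{x | f x = i} := by
  rw [card_eq_sum_card_fiberwise (f := f) (t := {i : Fin n | (i : ℕ) < r})]
  · refine sum_congr rfl fun i hi => ?_
    rw [filter_filter]
    congr 1
    ext x
    simp only [mem_filter, mem_univ, true_and] at hi ⊢
    constructor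
    · exact fun h => h.2
    · rintro rfl
      exact ⟨hi, rfl⟩
  · intro x hx
    simpa using hx

theorem card_filter_fst_lt {n : ℕ} {μ : YoungDiagram} (hμ : μ.card = n) (r : ℕ) :
    #{x ∈ μ.cells | x.1 < r} = ∑ i : Fin n with i.val < r, μ.rowLen i := by
  rw [card_eq_sum_card_fiberwise (f := Prod.fst)
    (t := ({i : Fin n | (i : ℕ) < r} : Finset (Fin n)).map Fin.valEmbedding), sum_map]
  · refine sum_congr rfl fun i hi => ?_
    rw [filter_filter, ← card_filter_fst_eq]
    congr 1
    ext x
    simp only [mem_filter, mem_univ, true_and, Fin.valEmbedding_apply] at hi ⊢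
    constructor
    · exact fun h => ⟨h.1, h.2.2⟩
    · exact fun h => ⟨h.1, h.2 ▸ hi, h.2⟩
  · intro x hx
    simp only [coe_filter, Set.mem_ofPred_eq, mem_cells] at hx
    have := (lt_card_of_mem hx.1).1
    simp only [coe_map, Set.mem_image, coe_filter, mem_univ, true_and, Set.mem_ofPred_eq]
    exact ⟨⟨x.1, by omega⟩, hx.2, rfl⟩

/-- Summed over the first `r` colours, the content exceeds that of `μ` by `∑ w i - ∑ i`, which is
nonnegative. -/
theorem HasContent.card_filter_le {n : ℕ} {μ : YoungDiagram} (hμ : μ.card = n)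
    {w : Equiv.Perm (Fin n)} {f : Fin n → Fin n} (h : μ.HasContent w f) (r : ℕ) :
    #{x ∈ μ.cells | x.1 < r} ≤ #{x | (f x : ℕ) < r} := by
  rw [card_filter_lt_eq_sum, card_filter_fst_lt hμ]
  have h1 : ∑ i : Fin n with i.val < r, (#{x | f x = i} + (i : ℕ)) =
      ∑ i : Fin n with i.val < r, (μ.rowLen i + w i) := sum_congr rfl fun i _ => h i
  rw [sum_add_distrib, sum_add_distrib] at h1
  have := sum_range_le_sum_perm w r
  omega

theorem HasContent.eq_one {n : ℕ} {μ : YoungDiagram} {w : Equiv.Perm (Fin n)} {f : Fin n → Fin n}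
    (h : μ.HasContent w f) (hf : ∀ i : Fin n, #{x | f x = i} = μ.rowLen i) : w = 1 := by
  ext i
  have := h i
  rw [hf] at this
  simp only [Equiv.Perm.coe_one, id_eq]
  omega

theorem hasContent_one_iff {n : ℕ} {μ : YoungDiagram} {f : Fin n → Fin n} :
    μ.HasContent 1 f ↔ ∀ i : Fin n, #{x | f x = i} = μ.rowLen i := by
  simp [HasContent]

/-- Two colourings with Jacobi–Trudi contents for `μ` and its transpose that are jointly injective
enumerate the cells of `μ`, and the contents are the leading ones. -/
theorem HasContent.image_eq_cells {n : ℕ} {μ : YoungDiagram} (hμ : μ.card = n)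
    {v w : Equiv.Perm (Fin n)} {f g : Fin n → Fin n} (hf : μ.HasContent v f)
    (hg : μ.transpose.HasContent w g) (hinj : Function.Injective fun x => (f x, g x)) :
    univ.image (fun x => ((f x : ℕ), (g x : ℕ))) = μ.cells ∧ v = 1 ∧ w = 1 := by
  have hinj' : Function.Injective fun x => ((f x : ℕ), (g x : ℕ)) := by
    intro x y h
    simp only [Prod.mk.injEq, Fin.val_inj] at h
    exact hinj (Prod.ext h.1 h.2)
  have h := YoungDiagram.image_eq_cells μ (fun x => (f x : ℕ)) (fun x => (g x : ℕ)) hinj'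
    (by simp [hμ]) (hf.card_filter_le hμ) (fun i => by
      rw [← card_filter_transpose_cells μ (fun a => a < i)]
      exact hg.card_filter_le (by rw [card_transpose, hμ]) i)
  refine ⟨h, hf.eq_one fun i => ?_, hg.eq_one fun i => ?_⟩
  · rw [← card_filter_fst_eq, ← card_filter_of_image_eq_cells hinj' h (fun x => x.1 = i)]
    simp [Fin.val_inj]
  · rw [rowLen_transpose, ← card_filter_snd_eq,
      ← card_filter_of_image_eq_cells hinj' h (fun x => x.2 = i)]
    simp [Fin.val_inj]

end YoungDiagram

/-! ### Young symmetrizers -/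

namespace SpechtChar

open Equiv Finset MonoidAlgebra

variable {n : ℕ} {μ : YoungDiagram}

theorem perm_apply_inv {X : Type*} (σ : Perm X) (x : X) : σ (σ⁻¹ x) = x := σ.apply_symm_apply x

/-- The sum of the permutations that fix the colouring `f`. -/
noncomputable def stabSum {ι : Type*} [DecidableEq ι] (f : Fin n → ι) :
    MonoidAlgebra ℂ (Perm (Fin n)) :=
  ∑ σ : Perm (Fin n) with ∀ x, f (σ x) = f x, single σ 1

/-- The signed sum of the column group. -/
noncomputable def colAntisum (t : {c // c ∈ μ.cells} ≃ Fin n) : MonoidAlgebra ℂ (Perm (Fin n)) :=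
  ∑ q ∈ colGroup t, single q (((Perm.sign q : ℤˣ) : ℤ) : ℂ)

theorem youngSymmetrizer_eq (t : {c // c ∈ μ.cells} ≃ Fin n) :
    youngSymmetrizer t = stabSum (fun x => (t.symm x).1.1) * colAntisum t := rfl

theorem card_eq_of_tableau (t : {c // c ∈ μ.cells} ≃ Fin n) : μ.card = n := by
  have := Fintype.card_congr t
  simpa using this

theorem stabSum_mul_single {ι : Type*} [DecidableEq ι] (f : Fin n → ι) {τ : Perm (Fin n)}
    (h : ∀ x, f (τ x) = f x) : stabSum f * single τ 1 = stabSum f := by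
  rw [stabSum, sum_mul]
  simp only [single_mul_single, mul_one]
  refine sum_equiv (Equiv.mulRight τ) (fun σ => ?_) (fun σ _ => rfl)
  simp only [mem_filter, mem_univ, true_and, coe_mulRight, Perm.mul_apply]
  constructor
  · intro hσ x
    rw [hσ, h]
  · intro hσ x
    have h1 := hσ (τ⁻¹ x)
    have h2 := h (τ⁻¹ x)
    simp only [perm_apply_inv] at h1 h2
    rw [h1, h2]

theorem single_mul_stabSum {ι : Type*} [DecidableEq ι] (f : Fin n → ι) {τ : Perm (Fin n)}
    (h : ∀ x, f (τ x) = f x) : single τ 1 * stabSum f = stabSum f := by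
  rw [stabSum, mul_sum]
  simp only [single_mul_single, mul_one]
  refine sum_equiv (Equiv.mulLeft τ) (fun σ => ?_) (fun σ _ => rfl)
  simp only [mem_filter, mem_univ, true_and, coe_mulLeft, Perm.mul_apply, h]

theorem single_mul_colAntisum (t : {c // c ∈ μ.cells} ≃ Fin n) {τ : Perm (Fin n)}
    (h : ∀ x, (t.symm (τ x)).1.2 = (t.symm x).1.2) :
    single τ 1 * colAntisum t = (((Perm.sign τ : ℤˣ) : ℤ) : ℂ) • colAntisum t := by
  rw [colAntisum, mul_sum, smul_sum]
  simp only [single_mul_single, one_mul, smul_single, smul_eq_mul]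
  refine sum_equiv (Equiv.mulLeft τ) (fun σ => ?_) (fun σ _ => ?_)
  · simp only [colGroup, mem_filter, mem_univ, true_and, coe_mulLeft, Perm.mul_apply, h]
  · simp only [coe_mulLeft, map_mul, Units.val_mul, Int.cast_mul, ← mul_assoc]
    rw [← Int.cast_mul, ← Units.val_mul, Int.units_mul_self]
    simp

/-- Two entries of one column that `σ` sends to the same colour give a transposition absorbed with
sign plus on the left and with sign minus on the right, so the product equals its own negative. -/
theorem stabSum_mul_single_mul_colAntisum_eq_zero {ι : Type*} [DecidableEq ι] (f : Fin n → ι)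
    (t : {c // c ∈ μ.cells} ≃ Fin n) (σ : Perm (Fin n))
    (h : ¬ Function.Injective fun x => (f (σ x), (t.symm x).1.2)) :
    stabSum f * single σ 1 * colAntisum t = 0 := by
  simp only [Function.Injective, not_forall, Prod.mk.injEq] at h
  obtain ⟨x, y, ⟨hf, hc⟩, hxy⟩ := h
  have h1 : stabSum f * single (swap (σ x) (σ y)) 1 = stabSum f := by
    apply stabSum_mul_single
    intro z
    rw [swap_apply_def]
    split_ifs with h h'
    · rw [h, hf]
    · rw [h', hf]
    · rfl
  have h2 : single (swap x y) 1 * colAntisum t = -colAntisum t := by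
    rw [single_mul_colAntisum, Perm.sign_swap hxy]
    · simp
    · intro z
      rw [swap_apply_def]
      split_ifs with h h'
      · rw [h, hc]
      · rw [h', hc]
      · rfl
  have h3 : single (swap (σ x) (σ y)) (1 : ℂ) * single σ 1 = single σ 1 * single (swap x y) 1 := by
    rw [single_mul_single, single_mul_single, mul_swap_eq_swap_mul]
  have h4 : stabSum f * single σ 1 * colAntisum t = -(stabSum f * single σ 1 * colAntisum t) := by
    conv_lhs => rw [← h1, mul_assoc (stabSum f), h3, ← mul_assoc, mul_assoc, h2, mul_neg]
  have h5 : (2 : ℂ) • (stabSum f * single σ 1 * colAntisum t) = 0 := by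
    rw [two_smul]
    nth_rewrite 1 [h4]
    exact neg_add_cancel _
  exact (smul_eq_zero.1 h5).resolve_left two_ne_zero

theorem stabSum_mul_mul_colAntisum_eq_zero {ι : Type*} [DecidableEq ι] (f : Fin n → ι)
    (t : {c // c ∈ μ.cells} ≃ Fin n)
    (h : ∀ σ : Perm (Fin n), ¬ Function.Injective fun x => (f (σ x), (t.symm x).1.2))
    (y : MonoidAlgebra ℂ (Perm (Fin n))) :
    stabSum f * y * colAntisum t = 0 := by
  induction y using MonoidAlgebra.induction_linear with
  | zero => simp
  | add x y hx hy => rw [mul_add, add_mul, hx, hy, add_zero]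
  | single σ r =>
    have : (single σ r : MonoidAlgebra ℂ (Perm (Fin n))) = r • single σ 1 := by
      rw [smul_single, smul_eq_mul, mul_one]
    rw [this, mul_smul_comm, smul_mul_assoc, stabSum_mul_single_mul_colAntisum_eq_zero f t σ (h σ),
      smul_zero]

theorem card_filter_tableau (t : {c // c ∈ μ.cells} ≃ Fin n) (P : ℕ × ℕ → Prop)
    [DecidablePred P] : #{x | P (t.symm x).1} = #{x ∈ μ.cells | P x} := by
  rw [← card_map (f := t.symm.toEmbedding.trans (Function.Embedding.subtype _))]
  congr 1
  ext x
  simp only [mem_map, mem_filter, mem_univ, true_and, Function.Embedding.trans_apply,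
    Equiv.coe_toEmbedding, Function.Embedding.subtype_apply]
  constructor
  · rintro ⟨y, hy, rfl⟩
    exact ⟨(t.symm y).2, hy⟩
  · rintro ⟨hx, hP⟩
    exact ⟨t ⟨x, hx⟩, by simpa using hP, by simp⟩

theorem card_filter_comp_perm {X : Type*} [Fintype X] (σ : Perm X) (P : X → Prop)
    [DecidablePred P] : #{x | P (σ x)} = #{x | P x} := by
  rw [← card_map (f := σ.toEmbedding)]
  congr 1
  ext x
  simp only [mem_map, mem_filter, mem_univ, true_and, Equiv.coe_toEmbedding]
  exact ⟨by rintro ⟨y, hy, rfl⟩; exact hy, fun h => ⟨σ⁻¹ x, by simpa using h, by simp⟩⟩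

/-- If `σ` sends no two entries of a column to the same row, it is a product of a row and a column
permutation. -/
theorem exists_mul_of_injective (t : {c // c ∈ μ.cells} ≃ Fin n) (σ : Perm (Fin n))
    (h : Function.Injective fun x => ((t.symm (σ x)).1.1, (t.symm x).1.2)) :
    ∃ r q : Perm (Fin n), (∀ x, (t.symm (r x)).1.1 = (t.symm x).1.1) ∧
      (∀ x, (t.symm (q x)).1.2 = (t.symm x).1.2) ∧ σ = r * q := by
  have him := μ.image_eq_cells (fun x => (t.symm (σ x)).1.1) (fun x => (t.symm x).1.2) h
    (by rw [Fintype.card_fin, card_eq_of_tableau t])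
    (fun i => by
      rw [card_filter_comp_perm σ (fun x => (t.symm x).1.1 < i),
        card_filter_tableau t (fun c => c.1 < i)])
    (fun i => (card_filter_tableau t (fun c => c.2 < i)).ge)
  have hmem : ∀ x, ((t.symm (σ x)).1.1, (t.symm x).1.2) ∈ μ.cells := fun x =>
    him.subset (mem_image_of_mem (fun x => ((t.symm (σ x)).1.1, (t.symm x).1.2)) (mem_univ x))
  -- The column permutation moves `x` within its column to the row of `σ x`; that position is a cell
  -- because the pairs (row of `σ x`, column of `x`) enumerate the diagram.
  let q₀ : Fin n → Fin n := fun x => t ⟨_, hmem x⟩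
  have hq₀ : Function.Injective q₀ := fun x y hxy => by
    have := t.injective hxy
    rw [Subtype.mk.injEq] at this
    exact h this
  let q : Perm (Fin n) := Equiv.ofBijective q₀ (Finite.injective_iff_bijective.1 hq₀)
  have hq : ∀ x, (t.symm (q x)).1 = ((t.symm (σ x)).1.1, (t.symm x).1.2) := fun x => by
    simp [q, q₀]
  refine ⟨σ * q⁻¹, q, fun x => ?_, fun x => by rw [hq], by simp⟩
  have := hq (q⁻¹ x)
  rw [perm_apply_inv] at this
  rw [this]
  rfl

/-- Von Neumann's lemma. By linearity `y` is a single permutation: either it is a row permutation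
times a column permutation, both absorbed up to sign, or the product vanishes. -/
theorem stabSum_mul_mul_colAntisum (t : {c // c ∈ μ.cells} ≃ Fin n)
    (y : MonoidAlgebra ℂ (Perm (Fin n))) :
    ∃ k : ℂ, stabSum (fun x => (t.symm x).1.1) * y * colAntisum t = k • youngSymmetrizer t := by
  induction y using MonoidAlgebra.induction_linear with
  | zero => exact ⟨0, by simp⟩
  | add x y hx hy =>
    obtain ⟨k, hk⟩ := hx
    obtain ⟨l, hl⟩ := hy
    exact ⟨k + l, by rw [mul_add, add_mul, hk, hl, add_smul]⟩
  | single σ s =>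
    have hs : (single σ s : MonoidAlgebra ℂ (Perm (Fin n))) = s • single σ 1 := by
      rw [smul_single, smul_eq_mul, mul_one]
    by_cases h : Function.Injective fun x => ((t.symm (σ x)).1.1, (t.symm x).1.2)
    · obtain ⟨r, q, hr, hq, rfl⟩ := exists_mul_of_injective t σ h
      refine ⟨s * (((Perm.sign q : ℤˣ) : ℤ) : ℂ), ?_⟩
      rw [hs, mul_smul_comm, smul_mul_assoc, mul_smul, youngSymmetrizer_eq]
      congr 1
      have : single (r * q) (1 : ℂ) = single r 1 * single q 1 := by simp [single_mul_single]
      rw [this, ← mul_assoc, stabSum_mul_single _ hr, mul_assoc, single_mul_colAntisum t hq,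
        mul_smul_comm]
    · refine ⟨0, ?_⟩
      rw [hs, mul_smul_comm, smul_mul_assoc, stabSum_mul_single_mul_colAntisum_eq_zero _ t σ h]
      simp

/-- Written as the cast of an integer because this integrality later makes the character real. -/
theorem coeff_youngSymmetrizer (t : {c // c ∈ μ.cells} ≃ Fin n) (g : Perm (Fin n)) :
    (youngSymmetrizer t).coeff g = ((∑ p ∈ rowGroup t, ∑ q ∈ colGroup t,
      if p * q = g then ((Perm.sign q : ℤˣ) : ℤ) else 0 : ℤ) : ℂ) := by
  rw [youngSymmetrizer, sum_mul_sum]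
  simp only [single_mul_single, one_mul, coeff_sum, Finsupp.finsetSum_apply, coeff_single,
    Finsupp.single_apply]
  push_cast
  rfl

/-- A permutation preserving both rows and columns is the identity, so only one product contributes.
-/
theorem coeff_one_youngSymmetrizer (t : {c // c ∈ μ.cells} ≃ Fin n) :
    (youngSymmetrizer t).coeff 1 = 1 := by
  rw [coeff_youngSymmetrizer]
  norm_cast
  rw [sum_eq_single 1, sum_eq_single 1]
  · simp
  · intro q _ hq
    simp [hq]
  · simp [colGroup]
  · intro p hp hp1
    refine sum_eq_zero fun q hq => if_neg fun hpq => hp1 ?_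
    ext x
    have hq' : q⁻¹ = p := by rw [inv_eq_iff_mul_eq_one]; exact mul_eq_one_comm.1 hpq
    simp only [rowGroup, colGroup, mem_filter, mem_univ, true_and] at hp hq
    have h1 := hp x
    have h2 := hq (p x)
    rw [← hq', perm_apply_inv, hq'] at h2
    have : t.symm (p x) = t.symm x := Subtype.ext (Prod.ext h1 h2.symm)
    rw [t.symm.injective this]
    rfl
  · simp [rowGroup]

theorem youngSymmetrizer_ne_zero (t : {c // c ∈ μ.cells} ≃ Fin n) : youngSymmetrizer t ≠ 0 := by
  intro h
  have := coeff_one_youngSymmetrizer t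
  simp [h] at this

theorem trace_mulRight (c : MonoidAlgebra ℂ (Perm (Fin n))) (g : Perm (Fin n)) :
    LinearMap.trace ℂ _ (LinearMap.mulLeft ℂ (single g (1 : ℂ)) ∘ₗ LinearMap.mulRight ℂ c) =
      ∑ x : Perm (Fin n), c.coeff (x⁻¹ * g⁻¹ * x) := by
  rw [LinearMap.trace_eq_matrix_trace ℂ (MonoidAlgebra.basis (Perm (Fin n)) ℂ), Matrix.trace]
  refine sum_congr rfl fun x _ => ?_
  rw [Matrix.diag_apply, LinearMap.toMatrix_apply]
  simp only [basis_apply, LinearMap.comp_apply, LinearMap.mulRight_apply, LinearMap.mulLeft_apply]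
  change (single g 1 * (single x 1 * c)).coeff x = _
  rw [← mul_assoc, single_mul_single, coeff_single_mul_eq_mul_coeff (x⁻¹ * g⁻¹ * x)]
  · simp
  · intro y _
    constructor
    · intro h
      rw [eq_comm, mul_assoc, inv_mul_eq_iff_eq_mul, inv_mul_eq_iff_eq_mul, ← mul_assoc]
      exact h.symm
    · rintro rfl
      group

/-- The Young symmetrizer is quasi-idempotent. -/
theorem exists_youngSymmetrizer_mul_self (t : {c // c ∈ μ.cells} ≃ Fin n) :
    ∃ h : ℝ, h ≠ 0 ∧ youngSymmetrizer t * youngSymmetrizer t = (h : ℂ) • youngSymmetrizer t := by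
  obtain ⟨k, hk⟩ := stabSum_mul_mul_colAntisum t
    (colAntisum t * stabSum (fun x => (t.symm x).1.1))
  have hk' : youngSymmetrizer t * youngSymmetrizer t = k • youngSymmetrizer t := by
    rw [← hk, youngSymmetrizer_eq]
    simp only [mul_assoc]
  -- If the square were zero, right multiplication by the symmetrizer would be nilpotent of trace
  -- zero, whereas its trace is `n!` times the coefficient at the identity.
  have hk0 : k ≠ 0 := by
    rintro rfl
    have hnil : IsNilpotent (LinearMap.mulRight ℂ (youngSymmetrizer t)) := by
      refine ⟨2, ?_⟩
      rw [pow_two, Module.End.mul_eq_comp, ← LinearMap.mulRight_mul, hk', zero_smul,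
        LinearMap.mulRight_zero_eq_zero]
    have h1 := (LinearMap.isNilpotent_trace_of_isNilpotent hnil).eq_zero
    have h2 := trace_mulRight (youngSymmetrizer t) 1
    rw [← MonoidAlgebra.one_def, LinearMap.mulLeft_one, LinearMap.id_comp, h1] at h2
    simp only [inv_one, mul_one, inv_mul_cancel, coeff_one_youngSymmetrizer, sum_const, card_univ,
      Fintype.card_perm, Fintype.card_fin, nsmul_eq_mul] at h2
    exact Nat.factorial_ne_zero n (by exact_mod_cast h2.symm)
  -- The scalar is the coefficient of the square at the identity, an integer.
  have hreal : (k.re : ℂ) = k := by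
    have h1 := congrArg (fun y => y.coeff 1) hk'
    simp only [coeff_smul_apply, coeff_one_youngSymmetrizer, smul_eq_mul, mul_one] at h1
    rw [← h1]
    have hint : ∀ g, ∃ z : ℤ, (youngSymmetrizer t).coeff g = z := fun g =>
      ⟨_, coeff_youngSymmetrizer t g⟩
    choose z hz using hint
    have : ∃ m : ℤ, (youngSymmetrizer t * youngSymmetrizer t).coeff 1 = m := by
      refine ⟨∑ g, ∑ g', if g * g' = 1 then z g * z g' else 0, ?_⟩
      rw [coeff_mul, Finsupp.sum_fintype _ _ (by simp)]
      push_cast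
      refine sum_congr rfl fun g _ => ?_
      rw [Finsupp.sum_fintype _ _ (by simp)]
      refine sum_congr rfl fun g' _ => ?_
      simp [hz]
    obtain ⟨m, hm⟩ := this
    rw [hm]
    simp
  exact ⟨k.re, by rwa [← Complex.ofReal_ne_zero, hreal], by rw [hreal, hk']⟩

end SpechtChar

/-! ### The character of the Specht module -/

namespace SpechtChar

open Equiv Finset MonoidAlgebra

variable {n : ℕ} {μ : YoungDiagram}

/-- The trace of the action of a group algebra element on the Specht module. -/
noncomputable def moduleTrace (t : {c // c ∈ μ.cells} ≃ Fin n) :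
    MonoidAlgebra ℂ (Perm (Fin n)) →ₗ[ℂ] ℂ :=
  LinearMap.trace ℂ (spechtModule t) ∘ₗ (Algebra.lsmul ℂ ℂ (spechtModule t)).toLinearMap

theorem irrCharacter_eq_moduleTrace (t : {c // c ∈ μ.cells} ≃ Fin n) (g : Perm (Fin n)) :
    irrCharacter t g = moduleTrace t (single g 1) := rfl

instance (t : {c // c ∈ μ.cells} ≃ Fin n) : FiniteDimensional ℂ (spechtModule t) :=
  inferInstanceAs (FiniteDimensional ℂ ((spechtModule t).restrictScalars ℂ))

theorem mem_spechtModule (t : {c // c ∈ μ.cells} ≃ Fin n) {v : MonoidAlgebra ℂ (Perm (Fin n))} :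
    v ∈ spechtModule t ↔ ∃ y, v = y * youngSymmetrizer t := by
  rw [spechtModule, Ideal.mem_span_singleton']
  exact ⟨fun ⟨y, hy⟩ => ⟨y, hy.symm⟩, fun ⟨y, hy⟩ => ⟨y, hy.symm⟩⟩

/-- An operator with image in a line is a functional times a spanning vector, so its trace is its
eigenvalue on that line. -/
theorem trace_eq_of_forall_mem_span {K V : Type*} [Field K] [AddCommGroup V] [Module K V]
    [FiniteDimensional K V] (T : V →ₗ[K] V) {v₀ : V} (hv₀ : v₀ ≠ 0) {κ : K}
    (h : ∀ v, ∃ k : K, T v = k • v₀) (hκ : T v₀ = κ • v₀) : LinearMap.trace K V T = κ := by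
  choose φ hφ using h
  have hinj : ∀ a b : K, a • v₀ = b • v₀ → a = b := fun a b hab => smul_left_injective K hv₀ hab
  let Φ : V →ₗ[K] K :=
    { toFun := φ
      map_add' := fun v w => hinj _ _ (by rw [add_smul, ← hφ, ← hφ, ← hφ, map_add])
      map_smul' := fun r v => hinj _ _ (by
        rw [← hφ, map_smul, hφ, RingHom.id_apply, smul_eq_mul, mul_smul]) }
  have hT : T = Φ.smulRight v₀ := LinearMap.ext fun v => hφ v
  rw [hT, LinearMap.trace_smulRight]
  exact hinj _ _ (by rw [← hκ, hφ]; rfl)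

theorem moduleTrace_eq_of_forall (t : {c // c ∈ μ.cells} ≃ Fin n)
    {z : MonoidAlgebra ℂ (Perm (Fin n))} {κ : ℂ}
    (h : ∀ y, ∃ k : ℂ, z * (y * youngSymmetrizer t) = k • youngSymmetrizer t)
    (hκ : z * youngSymmetrizer t = κ • youngSymmetrizer t) : moduleTrace t z = κ := by
  let v₀ : spechtModule t := ⟨youngSymmetrizer t, (mem_spechtModule t).2 ⟨1, (one_mul _).symm⟩⟩
  refine trace_eq_of_forall_mem_span (v₀ := v₀)
    (Algebra.lsmul ℂ ℂ (spechtModule t) z) ?_ ?_ ?_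
  · intro h0
    exact youngSymmetrizer_ne_zero t (congrArg Subtype.val h0)
  · rintro ⟨v, hv⟩
    obtain ⟨y, rfl⟩ := (mem_spechtModule t).1 hv
    obtain ⟨k, hk⟩ := h y
    exact ⟨k, Subtype.ext hk⟩
  · exact Subtype.ext hκ

/-- Under the hypothesis the stabilizer sum annihilates the whole Specht module. -/
theorem moduleTrace_stabSum_eq_zero {ι : Type*} [DecidableEq ι] (f : Fin n → ι)
    (t : {c // c ∈ μ.cells} ≃ Fin n)
    (h : ∀ σ : Perm (Fin n), ¬ Function.Injective fun x => (f (σ x), (t.symm x).1.2)) :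
    moduleTrace t (stabSum f) = 0 := by
  have h0 : ∀ y, stabSum f * (y * youngSymmetrizer t) = 0 := fun y => by
    rw [youngSymmetrizer_eq, ← mul_assoc y, ← mul_assoc]
    exact stabSum_mul_mul_colAntisum_eq_zero f t h _
  refine moduleTrace_eq_of_forall t (fun y => ⟨0, by rw [h0, zero_smul]⟩) ?_
  rw [zero_smul, ← h0 1, one_mul]

theorem stabSum_mul_self {ι : Type*} [DecidableEq ι] (f : Fin n → ι) :
    stabSum f * stabSum f = (#{σ : Perm (Fin n) | ∀ x, f (σ x) = f x} : ℂ) • stabSum f := by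
  conv_lhs => enter [1]; rw [stabSum]
  rw [sum_mul, sum_congr rfl fun σ hσ => single_mul_stabSum f (mem_filter.1 hσ).2, sum_const,
    ← Nat.cast_smul_eq_nsmul ℂ]

theorem moduleTrace_rowSum (t : {c // c ∈ μ.cells} ≃ Fin n) :
    moduleTrace t (stabSum fun x => (t.symm x).1.1) =
      #{σ : Perm (Fin n) | ∀ x, (t.symm (σ x)).1.1 = (t.symm x).1.1} := by
  apply moduleTrace_eq_of_forall
  · intro y
    rw [youngSymmetrizer_eq t, ← mul_assoc, ← mul_assoc]
    obtain ⟨k, hk⟩ := stabSum_mul_mul_colAntisum t (y * stabSum fun x => (t.symm x).1.1)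
    exact ⟨k, by rw [mul_assoc (stabSum _) y, hk, youngSymmetrizer_eq]⟩
  · rw [youngSymmetrizer_eq, ← mul_assoc, stabSum_mul_self, smul_mul_assoc]

theorem moduleTrace_mul_comm (t : {c // c ∈ μ.cells} ≃ Fin n)
    (y z : MonoidAlgebra ℂ (Perm (Fin n))) : moduleTrace t (y * z) = moduleTrace t (z * y) := by
  change LinearMap.trace ℂ _ (Algebra.lsmul ℂ ℂ (spechtModule t) (y * z)) =
    LinearMap.trace ℂ _ (Algebra.lsmul ℂ ℂ (spechtModule t) (z * y))
  rw [map_mul (Algebra.lsmul ℂ ℂ _), map_mul (Algebra.lsmul ℂ ℂ _), LinearMap.trace_mul_comm]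

theorem irrCharacter_conj (t : {c // c ∈ μ.cells} ≃ Fin n) (g x : Perm (Fin n)) :
    irrCharacter t (x * g * x⁻¹) = irrCharacter t g := by
  have : (single (x * g * x⁻¹) 1 : MonoidAlgebra ℂ (Perm (Fin n))) =
      single (x * g) 1 * single x⁻¹ 1 := by simp [single_mul_single]
  rw [irrCharacter_eq_moduleTrace, this, moduleTrace_mul_comm, single_mul_single,
    irrCharacter_eq_moduleTrace]
  simp

theorem irrCharacter_eq_of_isConj (t : {c // c ∈ μ.cells} ≃ Fin n) {g g' : Perm (Fin n)}
    (h : IsConj g g') : irrCharacter t g = irrCharacter t g' := by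
  obtain ⟨x, rfl⟩ := isConj_iff.1 h
  rw [irrCharacter_conj]

theorem irrCharacter_inv (t : {c // c ∈ μ.cells} ≃ Fin n) (g : Perm (Fin n)) :
    irrCharacter t g⁻¹ = irrCharacter t g :=
  irrCharacter_eq_of_isConj t (Perm.isConj_iff_cycleType_eq.2 (Perm.cycleType_inv g))

/-- Right multiplication by the symmetrizer, divided by `h`, projects the group algebra onto the
Specht module. The trace on the module is thus a trace on the whole algebra, computed in the basis
of permutations by `trace_mulRight`. -/
theorem irrCharacter_eq_sum (t : {c // c ∈ μ.cells} ≃ Fin n) {h : ℝ} (h0 : h ≠ 0)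
    (hh : youngSymmetrizer t * youngSymmetrizer t = (h : ℂ) • youngSymmetrizer t)
    (g : Perm (Fin n)) :
    irrCharacter t g = (h : ℂ)⁻¹ * ∑ x : Perm (Fin n),
      (youngSymmetrizer t).coeff (x⁻¹ * g⁻¹ * x) := by
  have h0' : (h : ℂ) ≠ 0 := Complex.ofReal_ne_zero.2 h0
  rw [← trace_mulRight, ← smul_eq_mul, ← map_smul]
  let inc : spechtModule t →ₗ[ℂ] MonoidAlgebra ℂ (Perm (Fin n)) :=
    ((spechtModule t).restrictScalars ℂ).subtype
  let prj : MonoidAlgebra ℂ (Perm (Fin n)) →ₗ[ℂ] spechtModule t :=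
    LinearMap.codRestrict ((spechtModule t).restrictScalars ℂ)
      ((h : ℂ)⁻¹ • LinearMap.mulRight ℂ (youngSymmetrizer t))
      (fun y => Submodule.smul_mem _ _ ((mem_spechtModule t).2 ⟨y, rfl⟩))
  have h1 : Algebra.lsmul ℂ ℂ (spechtModule t) (single g (1 : ℂ)) =
      prj ∘ₗ (LinearMap.mulLeft ℂ (single g (1 : ℂ)) ∘ₗ inc) := by
    refine LinearMap.ext ?_
    rintro ⟨v, hv⟩
    obtain ⟨y, rfl⟩ := (mem_spechtModule t).1 hv
    refine Subtype.ext ?_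
    change single g 1 * (y * youngSymmetrizer t) =
      (h : ℂ)⁻¹ • (single g 1 * (y * youngSymmetrizer t) * youngSymmetrizer t)
    rw [mul_assoc (single g 1), mul_assoc y, hh, mul_smul_comm, mul_smul_comm, smul_smul,
      inv_mul_cancel₀ h0', one_smul]
  change LinearMap.trace ℂ _ (Algebra.lsmul ℂ ℂ (spechtModule t) (single g 1)) = _
  rw [h1, LinearMap.trace_comp_comm', LinearMap.comp_assoc]
  congr 1
  refine LinearMap.ext fun y => ?_
  change single g 1 * ((h : ℂ)⁻¹ • (y * youngSymmetrizer t)) =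
    (h : ℂ)⁻¹ • (single g 1 * (y * youngSymmetrizer t))
  rw [mul_smul_comm]

theorem irrCharacter_real (t : {c // c ∈ μ.cells} ≃ Fin n) (g : Perm (Fin n)) :
    ∃ r : ℝ, irrCharacter t g = r := by
  obtain ⟨h, h0, hh⟩ := exists_youngSymmetrizer_mul_self t
  have hint : ∀ g, ∃ z : ℤ, (youngSymmetrizer t).coeff g = z := fun g =>
    ⟨_, coeff_youngSymmetrizer t g⟩
  choose z hz using hint
  refine ⟨h⁻¹ * ∑ x : Perm (Fin n), z (x⁻¹ * g⁻¹ * x), ?_⟩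
  rw [irrCharacter_eq_sum t h0 hh]
  simp only [hz]
  push_cast
  rfl

theorem moduleTrace_eq_sum (t : {c // c ∈ μ.cells} ≃ Fin n)
    (z : MonoidAlgebra ℂ (Perm (Fin n))) :
    moduleTrace t z = ∑ g, z.coeff g * irrCharacter t g := by
  conv_lhs => rw [← sum_coeff_single z, Finsupp.sum_fintype _ _ (by simp)]
  rw [map_sum]
  refine sum_congr rfl fun g _ => ?_
  rw [irrCharacter_eq_moduleTrace, ← smul_eq_mul, ← map_smul, smul_single, smul_eq_mul, mul_one]

/-- One factor is expanded by `irrCharacter_eq_sum`. For each `x` the remaining sum over `g` is the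
trace of the symmetrizer on its module, which is `h` and cancels the denominator. -/
theorem sum_irrCharacter_mul_self (t : {c // c ∈ μ.cells} ≃ Fin n) :
    ∑ g, irrCharacter t g * irrCharacter t g = (n.factorial : ℂ) := by
  obtain ⟨h, h0, hh⟩ := exists_youngSymmetrizer_mul_self t
  have h0' : (h : ℂ) ≠ 0 := Complex.ofReal_ne_zero.2 h0
  have htr : moduleTrace t (youngSymmetrizer t) = h := by
    refine moduleTrace_eq_of_forall t (fun y => ?_) hh
    obtain ⟨k, hk⟩ := stabSum_mul_mul_colAntisum t
      (colAntisum t * y * stabSum fun x => (t.symm x).1.1)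
    exact ⟨k, by rw [← hk, youngSymmetrizer_eq]; simp only [mul_assoc]⟩
  calc ∑ g, irrCharacter t g * irrCharacter t g
      = ∑ g, irrCharacter t g⁻¹ * irrCharacter t g := by simp only [irrCharacter_inv]
    _ = (h : ℂ)⁻¹ * ∑ x : Perm (Fin n), ∑ g : Perm (Fin n),
          (youngSymmetrizer t).coeff (x⁻¹ * g * x) * irrCharacter t g := by
        simp only [irrCharacter_eq_sum t h0 hh (_⁻¹), inv_inv]
        rw [sum_comm, mul_sum]
        refine sum_congr rfl fun g _ => ?_
        rw [mul_assoc, sum_mul]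
    _ = (h : ℂ)⁻¹ * ∑ x : Perm (Fin n), (h : ℂ) := by
        congr 1
        refine sum_congr rfl fun x _ => ?_
        rw [← htr, moduleTrace_eq_sum]
        refine sum_equiv (MulAut.conj x⁻¹).toEquiv (by simp) fun g _ => ?_
        simp only [MulEquiv.toEquiv_eq_coe, EquivLike.coe_coe, MulAut.conj_apply, inv_inv]
        congr 1
        simpa using (irrCharacter_conj t g x⁻¹).symm
    _ = _ := by
        rw [sum_const, card_univ, Fintype.card_perm, Fintype.card_fin, nsmul_eq_mul]
        field_simp

/-- The Jacobi–Trudi combination of permutation characters. -/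
def jacobiTrudi (μ : YoungDiagram) (g : Perm (Fin n)) : ℤ :=
  ∑ w : Perm (Fin n), (Perm.sign w : ℤ) * #{f : Fin n → Fin n | (∀ x, f (g x) = f x) ∧
    μ.HasContent w f}

/-- Exchanging the sums, the permutations fixing a given colouring assemble into its stabilizer sum.
-/
theorem sum_card_fixed_mul_irrCharacter (t : {c // c ∈ μ.cells} ≃ Fin n) (w : Perm (Fin n)) :
    ∑ g, (#{f : Fin n → Fin n | (∀ x, f (g x) = f x) ∧ μ.HasContent w f} : ℂ) *
      irrCharacter t g = ∑ f with μ.HasContent w f, moduleTrace t (stabSum f) := by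
  simp only [card_filter, Nat.cast_sum, sum_mul, Nat.cast_ite, Nat.cast_one, Nat.cast_zero,
    ite_mul, one_mul, zero_mul]
  rw [sum_comm, sum_filter]
  refine sum_congr rfl fun f _ => ?_
  split_ifs with h
  · simp only [h, and_true]
    rw [stabSum, map_sum, sum_filter]
    rfl
  · simp [h]

/-- The row colouring of a tableau. -/
def rowColor (t : {c // c ∈ μ.cells} ≃ Fin n) (x : Fin n) : Fin n :=
  ⟨(t.symm x).1.1,
    (YoungDiagram.lt_card_of_mem (t.symm x).2).1.trans_eq (card_eq_of_tableau t)⟩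

/-- The column colouring of a tableau. -/
def colColor (t : {c // c ∈ μ.cells} ≃ Fin n) (x : Fin n) : Fin n :=
  ⟨(t.symm x).1.2,
    (YoungDiagram.lt_card_of_mem (t.symm x).2).2.trans_eq (card_eq_of_tableau t)⟩

theorem card_rowColor (t : {c // c ∈ μ.cells} ≃ Fin n) (i : Fin n) :
    #{x | rowColor t x = i} = μ.rowLen i := by
  rw [← YoungDiagram.card_filter_fst_eq, ← card_filter_tableau t (fun c => c.1 = i)]
  simp only [rowColor, Fin.ext_iff]

theorem card_colColor (t : {c // c ∈ μ.cells} ≃ Fin n) (i : Fin n) :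
    #{x | colColor t x = i} = μ.colLen i := by
  rw [← YoungDiagram.card_filter_snd_eq, ← card_filter_tableau t (fun c => c.2 = i)]
  simp only [colColor, Fin.ext_iff]

theorem hasContent_comp_perm {w : Perm (Fin n)} {f : Fin n → Fin n} (σ : Perm (Fin n))
    (h : μ.HasContent w f) : μ.HasContent w (f ∘ σ) := fun i => by
  rw [← h i]
  congr 1
  exact card_filter_comp_perm σ (fun x => f x = i)

/-- A nonzero trace would need a colouring of this content jointly injective with the columns, and
domination then forces `w = 1`. -/
theorem sum_moduleTrace_of_ne_one (t : {c // c ∈ μ.cells} ≃ Fin n) {w : Perm (Fin n)}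
    (hw : w ≠ 1) : ∑ f with μ.HasContent w f, moduleTrace t (stabSum f) = 0 := by
  refine sum_eq_zero fun f hf => moduleTrace_stabSum_eq_zero f t fun σ hσ => hw ?_
  have hf' := hasContent_comp_perm σ (mem_filter.1 hf).2
  have hg : μ.transpose.HasContent 1 (colColor t) := by
    rw [YoungDiagram.hasContent_one_iff]
    intro i
    rw [card_colColor, YoungDiagram.rowLen_transpose]
  refine (hf'.image_eq_cells (card_eq_of_tableau t) hg fun x y hxy => hσ ?_).2.1
  simp only [Prod.mk.injEq, Function.comp_apply, colColor, Fin.ext_iff] at hxy ⊢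
  exact hxy

theorem exists_perm_comp_eq {X Y : Type*} [Fintype X] [DecidableEq Y] {f g : X → Y}
    (h : ∀ i, #{x | f x = i} = #{x | g x = i}) : ∃ σ : Perm X, f ∘ σ = g := by
  have h' : ∀ i, Nonempty ({x // g x = i} ≃ {x // f x = i}) := fun i => by
    rw [← Fintype.card_eq, Fintype.card_subtype, Fintype.card_subtype, h]
  exact ⟨Equiv.ofFiberEquiv fun i => (h' i).some, funext fun x => Equiv.ofFiberEquiv_map _ x⟩

/-- The colourings with the content of `μ` are the orbit of the row colouring. Each contributes the
order of the row group, so orbit–stabilizer gives `n!`. -/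
theorem sum_moduleTrace_one (t : {c // c ∈ μ.cells} ≃ Fin n) :
    ∑ f with μ.HasContent 1 f, moduleTrace t (stabSum f) = (n.factorial : ℂ) := by
  set R : Finset (Perm (Fin n)) := {σ | ∀ x, rowColor t (σ x) = rowColor t x} with hR
  have hR0 : (#R : ℂ) ≠ 0 := by
    rw [Nat.cast_ne_zero]
    exact (card_pos.2 ⟨1, by simp [hR]⟩).ne'
  have him : univ.image (fun σ : Perm (Fin n) => rowColor t ∘ σ) =
      univ.filter fun f => μ.HasContent 1 f := by
    ext f
    simp only [mem_image, mem_univ, true_and, mem_filter]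
    constructor
    · rintro ⟨σ, rfl⟩
      exact hasContent_comp_perm σ (YoungDiagram.hasContent_one_iff.2 (card_rowColor t))
    · intro hf
      refine exists_perm_comp_eq fun i => ?_
      rw [card_rowColor, YoungDiagram.hasContent_one_iff.1 hf]
  have hrow : moduleTrace t (stabSum (rowColor t)) = #R := by
    have h1 : stabSum (rowColor t) = stabSum fun x => (t.symm x).1.1 := by
      simp only [stabSum, rowColor, Fin.ext_iff]
    rw [h1, moduleTrace_rowSum]
    simp only [hR, rowColor, Fin.ext_iff]
  have hconj : ∀ σ : Perm (Fin n), moduleTrace t (stabSum (rowColor t ∘ σ)) = #R := fun σ => by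
    have h1 : stabSum (rowColor t ∘ σ) = single σ⁻¹ 1 * (stabSum (rowColor t) * single σ 1) := by
      simp only [stabSum, sum_mul, mul_sum, single_mul_single, mul_one]
      refine sum_equiv (MulAut.conj σ).toEquiv (fun τ => ?_) fun τ _ => ?_
      · simp only [mem_filter, mem_univ, true_and, MulEquiv.toEquiv_eq_coe, EquivLike.coe_coe,
          MulAut.conj_apply, Perm.mul_apply, Function.comp_apply]
        constructor
        · intro h x
          rw [h, perm_apply_inv]
        · intro h x
          simpa using h (σ x)
      · congr 1
        simp only [MulEquiv.toEquiv_eq_coe, EquivLike.coe_coe, MulAut.conj_apply]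
        group
    rw [h1, moduleTrace_mul_comm, mul_assoc, single_mul_single, mul_inv_cancel, mul_one,
      ← MonoidAlgebra.one_def, mul_one, hrow]
  -- Summing over permutations counts every colouring once for each element of a coset of its
  -- stabilizer, that is, `#R` times.
  have hsum : ∑ σ : Perm (Fin n), moduleTrace t (stabSum (rowColor t ∘ σ)) =
      #R * ∑ f with μ.HasContent 1 f, moduleTrace t (stabSum f) := by
    rw [sum_comp (fun f => moduleTrace t (stabSum f)) (fun σ : Perm (Fin n) => rowColor t ∘ σ), him,
      mul_sum]
    refine sum_congr rfl fun f hf => ?_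
    rw [← him] at hf
    obtain ⟨σ, -, rfl⟩ := mem_image.1 hf
    rw [nsmul_eq_mul]
    congr 2
    refine card_equiv (Equiv.mulRight σ⁻¹) fun τ => ?_
    simp only [mem_filter, mem_univ, true_and, hR, coe_mulRight, Perm.mul_apply]
    constructor
    · intro h x
      have := congrFun h (σ⁻¹ x)
      simpa using this
    · intro h
      funext x
      simpa using h (σ x)
  simp only [hconj, sum_const, card_univ, Fintype.card_perm, Fintype.card_fin, nsmul_eq_mul] at hsum
  rw [mul_comm] at hsum
  exact (mul_left_cancel₀ hR0 hsum).symm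

theorem sum_jacobiTrudi_mul_irrCharacter (t : {c // c ∈ μ.cells} ≃ Fin n) :
    ∑ g, (jacobiTrudi μ g : ℂ) * irrCharacter t g = (n.factorial : ℂ) := by
  simp only [jacobiTrudi, Int.cast_sum, Int.cast_mul, Int.cast_natCast, sum_mul, mul_assoc]
  rw [sum_comm]
  simp only [← mul_sum, sum_card_fixed_mul_irrCharacter]
  rw [sum_eq_single 1, sum_moduleTrace_one]
  · simp
  · intro w _ hw
    rw [sum_moduleTrace_of_ne_one t hw, mul_zero]
  · simp

end SpechtChar

/-! ### The norm of the Jacobi–Trudi combination. -/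

namespace SpechtChar

open Equiv Finset

variable {n : ℕ} {μ : YoungDiagram}

/-- If two points agree under both colourings, multiplication by their transposition is a
sign-reversing involution of the joint stabilizer; otherwise that stabilizer is trivial. -/
theorem sum_sign_fixing {ι κ : Type*} [DecidableEq ι] [DecidableEq κ] (f : Fin n → ι)
    (f' : Fin n → κ) :
    ∑ g : Perm (Fin n) with (∀ x, f (g x) = f x) ∧ ∀ x, f' (g x) = f' x, (Perm.sign g : ℤ) =
      if Function.Injective fun x => (f x, f' x) then 1 else 0 := by
  split_ifs with h
  · rw [sum_eq_single_of_mem 1 (by simp)]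
    · simp
    · intro g hg hg1
      refine absurd (Equiv.ext fun x => h ?_) hg1
      simp only [mem_filter, mem_univ, true_and] at hg
      simp [hg.1 x, hg.2 x]
  · simp only [Function.Injective, not_forall, Prod.mk.injEq] at h
    obtain ⟨x, y, ⟨hf, hf'⟩, hxy⟩ := h
    have hs : ∀ z, f (swap x y z) = f z ∧ f' (swap x y z) = f' z := fun z => by
      rw [swap_apply_def]
      split_ifs with h h'
      · rw [h, hf, hf']; simp
      · rw [h', hf, hf']; simp
      · simp
    have key : ∑ g : Perm (Fin n) with (∀ x, f (g x) = f x) ∧ ∀ x, f' (g x) = f' x,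
        (Perm.sign g : ℤ) = ∑ g : Perm (Fin n) with (∀ x, f (g x) = f x) ∧ ∀ x, f' (g x) = f' x,
        -(Perm.sign g : ℤ) := by
      refine sum_equiv (Equiv.mulLeft (swap x y)) (fun g => ?_) fun g _ => ?_
      · simp [Perm.mul_apply, hs]
      · simp [Perm.sign_swap hxy]
    rw [sum_neg_distrib] at key
    omega

/-- Such a pair records the row and the column of every entry of a bijective tableau, and the
tableaux are a torsor under `S_n`. -/
theorem card_jointly_injective (t : {c // c ∈ μ.cells} ≃ Fin n) :
    #{p : (Fin n → Fin n) × (Fin n → Fin n) | (μ.HasContent 1 p.1 ∧ μ.transpose.HasContent 1 p.2) ∧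
      Function.Injective fun x => (p.1 x, p.2 x)} = n.factorial := by
  have hcol : μ.transpose.HasContent 1 (colColor t) := by
    rw [YoungDiagram.hasContent_one_iff]
    intro i
    rw [card_colColor, YoungDiagram.rowLen_transpose]
  have hrow : μ.HasContent 1 (rowColor t) := YoungDiagram.hasContent_one_iff.2 (card_rowColor t)
  have hinj : ∀ x y, rowColor t x = rowColor t y → colColor t x = colColor t y → x = y := by
    intro x y h1 h2
    simp only [rowColor, colColor, Fin.ext_iff] at h1 h2
    exact t.symm.injective (Subtype.ext (Prod.ext h1 h2))
  conv_rhs => rw [← Fintype.card_fin n, ← Fintype.card_perm, ← card_univ]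
  symm
  refine card_bij (fun σ _ => (rowColor t ∘ σ, colColor t ∘ σ)) ?_ ?_ ?_
  · intro σ _
    simp only [mem_filter, mem_univ, true_and]
    refine ⟨⟨hasContent_comp_perm σ hrow, hasContent_comp_perm σ hcol⟩, fun x y hxy => ?_⟩
    simp only [Function.comp_apply, Prod.mk.injEq] at hxy
    exact σ.injective (hinj _ _ hxy.1 hxy.2)
  · intro σ _ τ _ h
    simp only [Prod.mk.injEq] at h
    exact Equiv.ext fun x => hinj _ _ (congrFun h.1 x) (congrFun h.2 x)
  · rintro ⟨f, f'⟩ h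
    simp only [mem_filter, mem_univ, true_and] at h
    have him := (h.1.1.image_eq_cells (card_eq_of_tableau t) h.1.2 h.2).1
    have hmem : ∀ x, ((f x : ℕ), (f' x : ℕ)) ∈ μ.cells := fun x =>
      him.subset (mem_image_of_mem (fun x => ((f x : ℕ), (f' x : ℕ))) (mem_univ x))
    let q : Fin n → Fin n := fun x => t ⟨_, hmem x⟩
    have hq : Function.Injective q := fun x y hxy => by
      have := t.injective hxy
      simp only [Subtype.mk.injEq, Prod.mk.injEq, Fin.val_inj] at this
      exact h.2 (Prod.ext this.1 this.2)
    refine ⟨Equiv.ofBijective q (Finite.injective_iff_bijective.1 hq), mem_univ _, ?_⟩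
    refine Prod.ext (funext fun x => ?_) (funext fun x => ?_) <;>
    simp [rowColor, colColor, q]

/-- After expansion the sum over `g` leaves only jointly injective pairs of colourings, and these
exist only for `v = w = 1`. -/
theorem sum_sign_mul_jacobiTrudi_mul (t : {c // c ∈ μ.cells} ≃ Fin n) :
    ∑ g : Perm (Fin n), (Perm.sign g : ℤ) * jacobiTrudi μ g * jacobiTrudi μ.transpose g =
      n.factorial := by
  have h1 : ∀ v w : Perm (Fin n), ∑ g : Perm (Fin n), (Perm.sign g : ℤ) *
      #{f : Fin n → Fin n | (∀ x, f (g x) = f x) ∧ μ.HasContent v f} *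
      #{f : Fin n → Fin n | (∀ x, f (g x) = f x) ∧ μ.transpose.HasContent w f} =
      #{p : (Fin n → Fin n) × (Fin n → Fin n) |
        (μ.HasContent v p.1 ∧ μ.transpose.HasContent w p.2) ∧
        Function.Injective fun x => (p.1 x, p.2 x)} := by
    intro v w
    have h2 : ∀ g : Perm (Fin n), (Perm.sign g : ℤ) *
        #{f : Fin n → Fin n | (∀ x, f (g x) = f x) ∧ μ.HasContent v f} *
        #{f : Fin n → Fin n | (∀ x, f (g x) = f x) ∧ μ.transpose.HasContent w f} =
        ∑ p : (Fin n → Fin n) × (Fin n → Fin n) with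
          μ.HasContent v p.1 ∧ μ.transpose.HasContent w p.2,
          if (∀ x, p.1 (g x) = p.1 x) ∧ ∀ x, p.2 (g x) = p.2 x then (Perm.sign g : ℤ) else 0 := by
      intro g
      rw [mul_assoc, ← Nat.cast_mul, ← card_product, ← sum_filter, filter_filter, sum_const,
        nsmul_eq_mul, mul_comm]
      congr 3
      ext p
      simp only [mem_product, mem_filter, mem_univ, true_and]
      tauto
    simp only [h2]
    rw [sum_comm]
    conv_rhs => rw [← filter_filter, card_filter, Nat.cast_sum]
    refine sum_congr rfl fun p _ => ?_
    rw [← sum_filter, sum_sign_fixing]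
    simp
  have h3 : ∑ g : Perm (Fin n), (Perm.sign g : ℤ) * jacobiTrudi μ g * jacobiTrudi μ.transpose g =
      ∑ v : Perm (Fin n), ∑ w : Perm (Fin n), (Perm.sign v : ℤ) * (Perm.sign w : ℤ) *
      #{p : (Fin n → Fin n) × (Fin n → Fin n) |
        (μ.HasContent v p.1 ∧ μ.transpose.HasContent w p.2) ∧
        Function.Injective fun x => (p.1 x, p.2 x)} := by
    simp only [← h1, mul_sum]
    rw [sum_congr rfl fun v _ => sum_comm, sum_comm]
    refine sum_congr rfl fun g _ => ?_
    rw [mul_assoc, jacobiTrudi, jacobiTrudi, sum_mul_sum, mul_sum]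
    refine sum_congr rfl fun v _ => ?_
    rw [mul_sum]
    refine sum_congr rfl fun w _ => ?_
    ring
  have h0 : ∀ v w : Perm (Fin n), ¬ (v = 1 ∧ w = 1) →
      #{p : (Fin n → Fin n) × (Fin n → Fin n) |
        (μ.HasContent v p.1 ∧ μ.transpose.HasContent w p.2) ∧
        Function.Injective fun x => (p.1 x, p.2 x)} = 0 := by
    intro v w hvw
    rw [card_eq_zero, filter_eq_empty_iff]
    rintro ⟨f, f'⟩ _ ⟨⟨hf, hf'⟩, hinj⟩
    exact hvw (hf.image_eq_cells (card_eq_of_tableau t) hf' hinj).2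
  rw [h3, sum_eq_single 1, sum_eq_single 1, card_jointly_injective t]
  · simp
  · intro w _ hw
    rw [h0 1 w (by tauto)]
    simp
  · simp
  · intro v _ hv
    refine sum_eq_zero fun w _ => ?_
    rw [h0 v w (by tauto)]
    simp
  · simp

/-- The irreducible character is the Jacobi–Trudi combination, provided the latter is compatible
with transposition. -/
theorem irrCharacter_eq_jacobiTrudi (t : {c // c ∈ μ.cells} ≃ Fin n)
    (htr : ∀ g : Perm (Fin n), jacobiTrudi μ.transpose g = (Perm.sign g : ℤ) * jacobiTrudi μ g)
    (g : Perm (Fin n)) : irrCharacter t g = jacobiTrudi μ g := by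
  choose χ hχ using irrCharacter_real t
  have h1 : ∑ g, χ g * χ g = n.factorial := by
    have := sum_irrCharacter_mul_self t
    simp only [hχ] at this
    exact_mod_cast this
  have h2 : ∑ g, (jacobiTrudi μ g : ℝ) * χ g = n.factorial := by
    have := sum_jacobiTrudi_mul_irrCharacter t
    simp only [hχ] at this
    exact_mod_cast this
  have h3 : ∑ g : Perm (Fin n), (jacobiTrudi μ g : ℝ) * jacobiTrudi μ g = n.factorial := by
    have := sum_sign_mul_jacobiTrudi_mul t
    have h4 : ∀ g : Perm (Fin n), (Perm.sign g : ℤ) * jacobiTrudi μ g * jacobiTrudi μ.transpose g =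
        jacobiTrudi μ g * jacobiTrudi μ g := fun g => by
      have hs : (Perm.sign g : ℤ) * (Perm.sign g : ℤ) = 1 := by
        rw [← Units.val_mul, Int.units_mul_self, Units.val_one]
      rw [htr]
      linear_combination (jacobiTrudi μ g * jacobiTrudi μ g) * hs
    simp only [h4] at this
    exact_mod_cast this
  -- The expansion is `n! - 2 n! + n!`.
  have h5 : ∑ g : Perm (Fin n), (χ g - jacobiTrudi μ g) ^ 2 = 0 := by
    have : ∀ g : Perm (Fin n), (χ g - jacobiTrudi μ g) ^ 2 = χ g * χ g -
        2 * ((jacobiTrudi μ g : ℝ) * χ g) + (jacobiTrudi μ g : ℝ) * jacobiTrudi μ g := fun g => by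
      ring
    simp only [this, sum_add_distrib, sum_sub_distrib, ← mul_sum, h1, h2, h3]
    ring
  have h6 := (sum_eq_zero_iff_of_nonneg fun g _ => sq_nonneg _).1 h5 g (mem_univ g)
  rw [hχ, sub_eq_zero.1 (pow_eq_zero_iff two_ne_zero |>.1 h6)]
  norm_cast

end SpechtChar

/-! ### One-body operators on functions of particle positions -/

namespace Fermion

open Equiv Finset Function

variable {N : ℕ}

/-- The partial map `f` applied to the position of the `j`-th particle. -/
def site (f : ℕ → Option ℕ) (j : Fin N) : ((Fin N → ℕ) → ℤ) →ₗ[ℤ] ((Fin N → ℕ) → ℤ) where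
  toFun A u := (f (u j)).elim 0 fun v => A (update u j v)
  map_add' A B := by
    funext u
    cases h : f (u j) <;> simp [h]
  map_smul' r A := by
    funext u
    cases h : f (u j) <;> simp [h]

theorem site_apply (f : ℕ → Option ℕ) (j : Fin N) (A : (Fin N → ℕ) → ℤ) (u : Fin N → ℕ) :
    site f j A u = (f (u j)).elim 0 fun v => A (update u j v) := rfl

theorem site_comm (f g : ℕ → Option ℕ) {i j : Fin N} (hij : i ≠ j) (A : (Fin N → ℕ) → ℤ) :
    site f i (site g j A) = site g j (site f i A) := by
  funext u
  simp only [site_apply]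
  cases hf : f (u i) <;> cases hg : g (u j) <;>
    simp [hf, hg, update_of_ne hij, update_of_ne hij.symm, update_comm hij]

/-- Operators act by pullback, so the outer map is applied to the position first. -/
theorem site_same (f g : ℕ → Option ℕ) (j : Fin N) (A : (Fin N → ℕ) → ℤ) :
    site f j (site g j A) = site (fun v => (f v).bind g) j A := by
  funext u
  simp only [site_apply]
  cases hf : f (u j) <;> simp

/-- The sum over the particles of the partial map `f` applied to the position of a particle. -/
def oneBody (N : ℕ) (f : ℕ → Option ℕ) : ((Fin N → ℕ) → ℤ) →ₗ[ℤ] ((Fin N → ℕ) → ℤ) :=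
  ∑ j, site f j

theorem oneBody_apply (f : ℕ → Option ℕ) (A : (Fin N → ℕ) → ℤ) (u : Fin N → ℕ) :
    oneBody N f A u = ∑ j, (f (u j)).elim 0 fun v => A (update u j v) := by
  simp [oneBody, site_apply]

theorem oneBody_eq (f : ℕ → Option ℕ) (A : (Fin N → ℕ) → ℤ) :
    oneBody N f A = ∑ j, site f j A := by
  simp [oneBody]

/-- Contributions of distinct particles commute, so the commutator is again one-body. The correction
terms are moved across to avoid subtraction. -/
theorem oneBody_comm (f g : ℕ → Option ℕ) (A : (Fin N → ℕ) → ℤ) :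
    oneBody N f (oneBody N g A) + oneBody N (fun v => (g v).bind f) A =
      oneBody N g (oneBody N f A) + oneBody N (fun v => (f v).bind g) A := by
  simp only [oneBody_eq, map_sum]
  have h : ∀ f g : ℕ → Option ℕ, ∑ i : Fin N, ∑ j, site f j (site g i A) =
      (∑ i : Fin N, ∑ j ∈ univ.erase i, site f j (site g i A)) +
      ∑ i : Fin N, site (fun v => (f v).bind g) i A := fun f g => by
    rw [← sum_add_distrib]
    refine sum_congr rfl fun i _ => ?_
    rw [← sum_erase_add _ _ (mem_univ i), site_same]
  rw [h f g, h g f, add_assoc, add_assoc, add_comm (∑ i, site (fun v => (f v).bind g) i A)]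
  congr 1
  have h' : ∀ f g : ℕ → Option ℕ, ∑ i : Fin N, ∑ j ∈ univ.erase i, site f j (site g i A) =
      ∑ i : Fin N, ∑ j, if j ≠ i then site f j (site g i A) else 0 := fun f g => by
    refine sum_congr rfl fun i _ => ?_
    rw [← sum_filter]
    refine sum_congr ?_ fun _ _ => rfl
    ext j
    simp
  rw [h', h', sum_comm]
  refine sum_congr rfl fun i _ => sum_congr rfl fun j _ => ?_
  by_cases hij : j = i
  · simp [hij]
  · rw [if_pos hij, if_pos (Ne.symm hij), site_comm f g (Ne.symm hij)]

/-- Functions of the positions that are antisymmetric in the particles. -/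
def IsAlt (A : (Fin N → ℕ) → ℤ) : Prop :=
  ∀ (u : Fin N → ℕ) (σ : Perm (Fin N)), A (u ∘ σ) = (Perm.sign σ : ℤ) * A u

theorem IsAlt.eq_zero {A : (Fin N → ℕ) → ℤ} (hA : IsAlt A) {u : Fin N → ℕ} {i j : Fin N}
    (hij : i ≠ j) (h : u i = u j) : A u = 0 := by
  have h1 := hA u (swap i j)
  have h2 : u ∘ swap i j = u := by
    funext x
    simp only [comp_apply, swap_apply_def]
    split_ifs with h3 h4
    · rw [h3, h]
    · rw [h4, h]
    · rfl
  rw [h2, Perm.sign_swap hij] at h1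
  simp only [Units.val_neg, Units.val_one] at h1
  omega

theorem IsAlt.oneBody {A : (Fin N → ℕ) → ℤ} (hA : IsAlt A) (f : ℕ → Option ℕ) :
    IsAlt (oneBody N f A) := by
  intro u σ
  rw [oneBody_apply, oneBody_apply, mul_sum]
  refine sum_equiv σ (by simp) fun j _ => ?_
  simp only [comp_apply]
  cases f (u (σ j)) with
  | none => simp
  | some v =>
    simp only [Option.elim_some]
    rw [← hA]
    congr 1
    funext x
    by_cases hx : x = j
    · simp [hx]
    · simp [hx]

/-- Raising a particle by `m`. -/
def raise (N m : ℕ) : ((Fin N → ℕ) → ℤ) →ₗ[ℤ] ((Fin N → ℕ) → ℤ) :=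
  oneBody N fun v => some (v + m)

/-- Moving a particle from the depth `q` below the Fermi level `N` to the height `p` above it. -/
def excite (N : ℕ) (x : ℕ × ℕ) : ((Fin N → ℕ) → ℤ) →ₗ[ℤ] ((Fin N → ℕ) → ℤ) :=
  oneBody N fun v => if v + x.2 + 1 = N then some (N + x.1) else none

theorem IsAlt.excite {A : (Fin N → ℕ) → ℤ} (hA : IsAlt A) (x : ℕ × ℕ) : IsAlt (excite N x A) :=
  hA.oneBody _

theorem IsAlt.raise {A : (Fin N → ℕ) → ℤ} (hA : IsAlt A) (m : ℕ) : IsAlt (raise N m A) :=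
  hA.oneBody _

/-- An excited particle sits at or above the level `N` and cannot be excited again, so both
composites in the commutator vanish. -/
theorem excite_comm (x y : ℕ × ℕ) (A : (Fin N → ℕ) → ℤ) :
    excite N x (excite N y A) = excite N y (excite N x A) := by
  have h := oneBody_comm (fun v => if v + x.2 + 1 = N then some (N + x.1) else none)
    (fun v => if v + y.2 + 1 = N then some (N + y.1) else none) A
  have h0 : ∀ x y : ℕ × ℕ, (fun v => (if v + x.2 + 1 = N then some (N + x.1) else none).bind
      fun v => if v + y.2 + 1 = N then some (N + y.1) else none) = fun _ => none := by
    intro x y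
    funext v
    split_ifs with h
    · rw [Option.bind_some, if_neg (by omega)]
    · rfl
  rw [h0 x y, h0 y x] at h
  exact add_right_cancel h

/-- The source of the signs of linear blocks: raising after the excitation lifts its target, while
raising before it deepens its source and enters with a minus. -/
theorem excite_raise (m : ℕ) (x : ℕ × ℕ) (A : (Fin N → ℕ) → ℤ) :
    excite N x (raise N m A) = raise N m (excite N x A) + excite N (x.1 + m, x.2) A -
      excite N (x.1, x.2 + m) A := by
  have h := oneBody_comm (fun v => if v + x.2 + 1 = N then some (N + x.1) else none)
    (fun v => some (v + m)) A
  have h1 : (fun v => (some (v + m)).bind fun v => if v + x.2 + 1 = N then some (N + x.1)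
      else none) = fun v => if v + (x.2 + m) + 1 = N then some (N + x.1) else none := by
    funext v
    rw [Option.bind_some, show v + m + x.2 + 1 = v + (x.2 + m) + 1 by ring]
  have h2 : (fun v => (if v + x.2 + 1 = N then some (N + x.1) else none).bind
      fun v => some (v + m)) = fun v => if v + x.2 + 1 = N then some (N + (x.1 + m)) else none := by
    funext v
    split_ifs
    · rw [Option.bind_some, add_assoc]
    · rfl
  rw [h1, h2] at h
  exact eq_sub_of_add_eq h

/-- The positions of the particles in the vacuum. -/
def vacuum (N : ℕ) (i : Fin N) : ℕ := N - 1 - i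

/-- Particle `i < m` jumps above the Fermi level, which is the excitation `(m - 1 - i, i)`; particle
`i ≥ m` lands on particle `i - m`, and antisymmetry kills the term. -/
theorem raise_vacuum {A : (Fin N → ℕ) → ℤ} (hA : IsAlt A) {m : ℕ} (hm : 0 < m) :
    raise N m A (vacuum N) = ∑ x ∈ antidiagonal (m - 1), excite N x A (vacuum N) := by
  simp only [raise, excite, oneBody_apply, Option.elim_some]
  rw [sum_comm]
  refine sum_congr rfl fun i _ => ?_
  have hi := i.2
  by_cases him : (i : ℕ) < m
  · rw [sum_eq_single_of_mem (m - 1 - i, (i : ℕ)) (by rw [HasAntidiagonal.mem_antidiagonal]; omega)]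
    · rw [if_pos (by simp only [vacuum]; omega), Option.elim_some]
      congr 2
      simp only [vacuum]
      omega
    · rintro ⟨p, q⟩ hpq hne
      rw [HasAntidiagonal.mem_antidiagonal] at hpq
      rw [if_neg, Option.elim_none]
      simp only [vacuum]
      intro h
      apply hne
      simp only at hpq
      ext <;> simp <;> omega
  · rw [sum_eq_zero]
    · refine hA.eq_zero (i := i) (j := ⟨i - m, by omega⟩) ?_ ?_
      · rw [Ne, Fin.ext_iff]
        simp only
        omega
      · rw [update_self, update_of_ne]
        · simp only [vacuum]
          omega
        · rw [Ne, Fin.ext_iff]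
          simp only
          omega
    · rintro ⟨p, q⟩ hpq
      rw [HasAntidiagonal.mem_antidiagonal] at hpq
      simp only at hpq
      rw [if_neg, Option.elim_none]
      simp only [vacuum]
      omega

/-- Evaluation at the vacuum with the given excitations. -/
def state (N : ℕ) (s : Multiset (ℕ × ℕ)) : ((Fin N → ℕ) → ℤ) →ₗ[ℤ] ℤ :=
  haveI : LeftCommutative fun (x : ℕ × ℕ) (φ : ((Fin N → ℕ) → ℤ) →ₗ[ℤ] ℤ) => φ ∘ₗ excite N x :=
    ⟨fun x y φ => LinearMap.ext fun A => congrArg φ (excite_comm y x A)⟩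
  s.foldr (fun x φ => φ ∘ₗ excite N x) (LinearMap.proj (vacuum N))

theorem state_zero (A : (Fin N → ℕ) → ℤ) : state N 0 A = A (vacuum N) := rfl

theorem state_cons (x : ℕ × ℕ) (s : Multiset (ℕ × ℕ)) (A : (Fin N → ℕ) → ℤ) :
    state N (x ::ₘ s) A = state N s (excite N x A) := by
  simp only [state, Multiset.foldr_cons, LinearMap.comp_apply]

/-- The raising operator is commuted past the excitations down to the vacuum. The three groups of
terms correspond to a new hook block, a horizontal block and a vertical block added to the list of
fragments. -/
theorem state_raise {m : ℕ} (hm : 0 < m) (s : Multiset (ℕ × ℕ)) {A : (Fin N → ℕ) → ℤ}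
    (hA : IsAlt A) : state N s (raise N m A) = ∑ x ∈ antidiagonal (m - 1), state N (x ::ₘ s) A +
      ((s.map fun x => state N ((x.1 + m, x.2) ::ₘ s.erase x) A).sum -
      (s.map fun x => state N ((x.1, x.2 + m) ::ₘ s.erase x) A).sum) := by
  induction s using Multiset.induction generalizing A with
  | empty =>
    simp only [Multiset.map_zero, Multiset.sum_zero, sub_zero, add_zero, state_cons, state_zero]
    exact raise_vacuum hA hm
  | cons a s ih =>
    have hswap : ∀ x (s : Multiset (ℕ × ℕ)), state N (x ::ₘ s) (excite N a A) =
        state N (x ::ₘ a ::ₘ s) A := fun x s => by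
      rw [Multiset.cons_swap, state_cons a]
    have hmap : ∀ g : ℕ × ℕ → ℕ × ℕ,
        (s.map fun x => state N (g x ::ₘ (a ::ₘ s).erase x) A) =
        s.map fun x => state N (g x ::ₘ s.erase x) (excite N a A) := fun g =>
      Multiset.map_congr rfl fun x hx => by
        rw [hswap, Multiset.erase_cons_tail_of_mem hx]
    rw [state_cons, excite_raise, map_sub, map_add, ih (hA.excite a)]
    simp only [Multiset.map_cons, Multiset.sum_cons, Multiset.erase_cons_head, hmap, hswap]
    simp only [state_cons]
    ring

end Fermion

/-! ### Filled structures encoded by the map to the hook blocks -/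

namespace FilledStructure

open Finset Fermion

variable {k : ℕ}

/-- `h` sends every block to the hook block of its fragment. -/
def IsHookMap (b : Fin k → FilledBlock) (h : Fin k → Fin k) : Prop :=
  ∀ i, h i ≤ i ∧ (b (h i)).isHook = true ∧ ((b i).isHook = true → h i = i)

/-- The indices of the hook blocks. -/
def hookSet (b : Fin k → FilledBlock) : Finset (Fin k) := {i | (b i).isHook = true}

/-- The contribution of a block to the filling numbers of its fragment. -/
def numPair (b : FilledBlock) : ℕ × ℕ := (b.pNum, b.qNum)

/-- The filling numbers of the fragment with the hook block `i`. -/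
def fragPair (b : Fin k → FilledBlock) (h : Fin k → Fin k) (i : Fin k) : ℕ × ℕ :=
  ∑ j with h j = i, numPair (b j)

/-- The filling numbers of all fragments. -/
def fragPairs (b : Fin k → FilledBlock) (h : Fin k → Fin k) : Multiset (ℕ × ℕ) :=
  (hookSet b).val.map (fragPair b h)

/-- The number of vertical blocks. -/
def verticalCount (b : Fin k → FilledBlock) : ℕ := #{i | (b i).isVertical = true}

theorem finite_codes (ρ : Fin k → ℕ) :
    {c : (Fin k → FilledBlock) × (Fin k → Fin k) |
      (∀ i, (c.1 i).card = ρ i) ∧ IsHookMap c.1 c.2}.Finite := by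
  have h1 : (Set.univ.pi fun i => {b : FilledBlock | b.card = ρ i}).Finite :=
    Set.Finite.pi fun i => FilledBlock.finite_card_eq (ρ i)
  refine (h1.prod (Set.finite_univ (α := Fin k → Fin k))).subset ?_
  rintro ⟨b, h⟩ hc
  exact ⟨fun i _ => hc.1 i, Set.mem_univ _⟩

/-- The encodings of the filled structures of cardinality `ρ`. -/
noncomputable def codes (ρ : Fin k → ℕ) : Finset ((Fin k → FilledBlock) × (Fin k → Fin k)) :=
  (finite_codes ρ).toFinset

theorem mem_codes {ρ : Fin k → ℕ} {c : (Fin k → FilledBlock) × (Fin k → Fin k)} :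
    c ∈ codes ρ ↔ (∀ i, (c.1 i).card = ρ i) ∧ IsHookMap c.1 c.2 := by
  simp [codes]

/-- Adding a new last block `x` to the fragment of the hook block `t`. -/
def extend (c : (Fin k → FilledBlock) × (Fin k → Fin k)) (x : FilledBlock) (t : Fin (k + 1)) :
    (Fin (k + 1) → FilledBlock) × (Fin (k + 1) → Fin (k + 1)) :=
  (Fin.snoc (α := fun _ => FilledBlock) c.1 x,
    Fin.snoc (α := fun _ => Fin (k + 1)) (fun i => (c.2 i).castSucc) t)

section extend

variable (c : (Fin k → FilledBlock) × (Fin k → Fin k)) (x : FilledBlock) (t : Fin (k + 1))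

@[simp] theorem extend_fst_castSucc (i : Fin k) : (extend c x t).1 i.castSucc = c.1 i := by
  simp [extend]

@[simp] theorem extend_fst_last : (extend c x t).1 (Fin.last k) = x := by
  simp [extend]

@[simp] theorem extend_snd_castSucc (i : Fin k) :
    (extend c x t).2 i.castSucc = (c.2 i).castSucc := by
  simp [extend]

@[simp] theorem extend_snd_last : (extend c x t).2 (Fin.last k) = t := by
  simp [extend]

theorem fragPair_extend_castSucc (i : Fin k) :
    fragPair (extend c x t).1 (extend c x t).2 i.castSucc =
      fragPair c.1 c.2 i + if t = i.castSucc then numPair x else 0 := by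
  simp [fragPair, sum_filter, Fin.sum_univ_castSucc]

theorem fragPair_extend_last :
    fragPair (extend c x t).1 (extend c x t).2 (Fin.last k) =
      if t = Fin.last k then numPair x else 0 := by
  simp [fragPair, sum_filter, Fin.sum_univ_castSucc, (Fin.castSucc_lt_last _).ne]

theorem verticalCount_extend : verticalCount (extend c x t).1 =
    verticalCount c.1 + if x.isVertical = true then 1 else 0 := by
  rw [verticalCount, verticalCount, card_filter, card_filter, Fin.sum_univ_castSucc]
  simp only [extend_fst_castSucc, extend_fst_last]

theorem hookSet_extend_of_isHook (hx : x.isHook = true) : hookSet (extend c x t).1 =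
    cons (Fin.last k) ((hookSet c.1).map Fin.castSuccEmb)
      (by simp [(Fin.castSucc_lt_last _).ne]) := by
  ext i
  induction i using Fin.lastCases with
  | last => simp [hookSet, hx]
  | cast i => simp [hookSet, (Fin.castSucc_lt_last _).ne]

theorem hookSet_extend_of_not_isHook (hx : x.isHook = false) : hookSet (extend c x t).1 =
    (hookSet c.1).map Fin.castSuccEmb := by
  ext i
  induction i using Fin.lastCases with
  | last => simp [hookSet, hx, (Fin.castSucc_lt_last _).ne]
  | cast i => simp [hookSet]

theorem fragPairs_extend_last (hx : x.isHook = true) :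
    fragPairs (extend c x (Fin.last k)).1 (extend c x (Fin.last k)).2 =
      numPair x ::ₘ fragPairs c.1 c.2 := by
  rw [fragPairs, hookSet_extend_of_isHook _ _ _ hx, cons_val, Multiset.map_cons,
    fragPair_extend_last, if_pos rfl, map_val, Multiset.map_map, fragPairs]
  congr 1
  refine Multiset.map_congr rfl fun i _ => ?_
  simp [fragPair_extend_castSucc, (Fin.castSucc_lt_last _).ne']

theorem fragPairs_extend_castSucc (hx : x.isHook = false) {i : Fin k} (hi : i ∈ hookSet c.1) :
    fragPairs (extend c x i.castSucc).1 (extend c x i.castSucc).2 =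
      (fragPair c.1 c.2 i + numPair x) ::ₘ (fragPairs c.1 c.2).erase (fragPair c.1 c.2 i) := by
  classical
  rw [fragPairs, hookSet_extend_of_not_isHook _ _ _ hx, map_val, Multiset.map_map, fragPairs,
    ← insert_erase hi, insert_val_of_notMem (notMem_erase _ _), Multiset.map_cons,
    Multiset.map_cons, Multiset.erase_cons_head]
  congr 1
  · simp [fragPair_extend_castSucc]
  · refine Multiset.map_congr rfl fun j hj => ?_
    have hj' : j ≠ i := ne_of_mem_erase (mem_def.2 hj)
    simp [fragPair_extend_castSucc, hj'.symm]

theorem isHookMap_extend : IsHookMap (extend c x t).1 (extend c x t).2 ↔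
    IsHookMap c.1 c.2 ∧ ((x.isHook = true ∧ t = Fin.last k) ∨
      (x.isHook = false ∧ ∃ i ∈ hookSet c.1, t = i.castSucc)) := by
  rw [IsHookMap, Fin.forall_fin_succ']
  simp only [extend_snd_castSucc, extend_fst_castSucc, Fin.castSucc_le_castSucc_iff,
    Fin.castSucc_inj, extend_snd_last, extend_fst_last]
  refine and_congr Iff.rfl ?_
  induction t using Fin.lastCases with
  | last => simp [(Fin.castSucc_lt_last _).ne']
  | cast i =>
    simp only [extend_fst_castSucc, (Fin.castSucc_lt_last i).le, (Fin.castSucc_lt_last i).ne,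
      hookSet, mem_filter, mem_univ, true_and, Fin.castSucc_inj]
    cases x.isHook <;> simp

end extend

theorem exists_eq_extend (c : (Fin (k + 1) → FilledBlock) × (Fin (k + 1) → Fin (k + 1)))
    (hc : IsHookMap c.1 c.2) : ∃ c' x t, c = extend (k := k) c' x t := by
  have h : ∀ i : Fin k, (c.2 i.castSucc) ≠ Fin.last k := fun i hi => by
    have := (hc i.castSucc).1
    rw [hi] at this
    exact absurd this (not_le.2 (Fin.castSucc_lt_last i))
  refine ⟨(fun i => c.1 i.castSucc, fun i => (c.2 i.castSucc).castPred (h i)), c.1 (Fin.last k),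
    c.2 (Fin.last k), Prod.ext (funext fun i => ?_) (funext fun i => ?_)⟩ <;>
  induction i using Fin.lastCases <;> simp

theorem extend_injective {c c' : (Fin k → FilledBlock) × (Fin k → Fin k)} {x x' : FilledBlock}
    {t t' : Fin (k + 1)} (h : extend c x t = extend c' x' t') : c = c' ∧ x = x' ∧ t = t' := by
  have h1 := fun i => congrFun (congrArg Prod.fst h) i
  have h2 := fun i => congrFun (congrArg Prod.snd h) i
  refine ⟨Prod.ext (funext fun i => ?_) (funext fun i => ?_), ?_, ?_⟩
  · simpa using h1 i.castSucc
  · simpa using h2 i.castSucc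
  · simpa using h1 (Fin.last k)
  · simpa using h2 (Fin.last k)

/-- The last block together with its target hook block, for the three types of blocks. -/
def lastBlock (k : ℕ) (m : ℕ+) : (ℕ × ℕ) ⊕ (Fin k ⊕ Fin k) → FilledBlock × Fin (k + 1)
  | Sum.inl x => (FilledBlock.hook x.1 x.2, Fin.last k)
  | Sum.inr (Sum.inl i) => (FilledBlock.horizontal m, i.castSucc)
  | Sum.inr (Sum.inr i) => (FilledBlock.vertical m, i.castSucc)

/-- The last block either opens a fragment, and is then a hook, or is a linear block of forced
filling number joined to an existing hook. -/
theorem sum_codes_succ (ρ : Fin (k + 1) → ℕ) (hρ : 0 < ρ (Fin.last k))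
    (F : (Fin (k + 1) → FilledBlock) × (Fin (k + 1) → Fin (k + 1)) → ℤ) :
    ∑ c ∈ codes ρ, F c = ∑ c ∈ codes (fun i => ρ i.castSucc),
      (∑ x ∈ antidiagonal (ρ (Fin.last k) - 1),
        F (extend c (FilledBlock.hook x.1 x.2) (Fin.last k)) +
      (∑ i ∈ hookSet c.1, F (extend c (FilledBlock.horizontal ⟨_, hρ⟩) i.castSucc) +
        ∑ i ∈ hookSet c.1, F (extend c (FilledBlock.vertical ⟨_, hρ⟩) i.castSucc))) := by
  have h : ∀ c : (Fin k → FilledBlock) × (Fin k → Fin k),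
      (∑ x ∈ antidiagonal (ρ (Fin.last k) - 1),
        F (extend c (FilledBlock.hook x.1 x.2) (Fin.last k)) +
      (∑ i ∈ hookSet c.1, F (extend c (FilledBlock.horizontal ⟨_, hρ⟩) i.castSucc) +
        ∑ i ∈ hookSet c.1, F (extend c (FilledBlock.vertical ⟨_, hρ⟩) i.castSucc))) =
      ∑ e ∈ (antidiagonal (ρ (Fin.last k) - 1)).disjSum ((hookSet c.1).disjSum (hookSet c.1)),
        F (extend c (lastBlock k ⟨_, hρ⟩ e).1 (lastBlock k ⟨_, hρ⟩ e).2) := fun c => by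
    rw [sum_disjSum, sum_disjSum]
    rfl
  simp only [h]
  rw [sum_sigma']
  symm
  refine sum_bij (fun e _ => extend e.1 (lastBlock k ⟨_, hρ⟩ e.2).1 (lastBlock k ⟨_, hρ⟩ e.2).2)
    ?_ ?_ ?_ (fun _ _ => rfl)
  · rintro ⟨c, e⟩ he
    rw [mem_sigma, mem_codes] at he
    obtain ⟨⟨hcard, hmap⟩, he⟩ := he
    rw [mem_codes, Fin.forall_fin_succ', isHookMap_extend]
    simp only [extend_fst_castSucc, extend_fst_last]
    refine ⟨⟨hcard, ?_⟩, hmap, ?_⟩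
    · rcases e with x | i | i
      · simp only [inl_mem_disjSum, HasAntidiagonal.mem_antidiagonal] at he
        simp only [lastBlock, FilledBlock.card]
        omega
      · rfl
      · rfl
    · rcases e with x | i | i
      · exact Or.inl ⟨rfl, rfl⟩
      · exact Or.inr ⟨rfl, i, by simpa using he, rfl⟩
      · exact Or.inr ⟨rfl, i, by simpa using he, rfl⟩
  · rintro ⟨c, e⟩ - ⟨c', e'⟩ - heq
    obtain ⟨rfl, h1, h2⟩ := extend_injective heq
    congr 1
    rcases e with x | i | i <;> rcases e' with x' | i' | i' <;>
      simp_all [lastBlock, Prod.ext_iff]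
  · intro c hc
    rw [mem_codes] at hc
    obtain ⟨hcard, hmap⟩ := hc
    obtain ⟨c, x, t, rfl⟩ := exists_eq_extend c hmap
    rw [isHookMap_extend] at hmap
    obtain ⟨hmap, hxt⟩ := hmap
    rw [Fin.forall_fin_succ'] at hcard
    simp only [extend_fst_castSucc, extend_fst_last] at hcard
    have hc : c ∈ codes (fun i => ρ i.castSucc) := mem_codes.2 ⟨hcard.1, hmap⟩
    have hx := hcard.2
    rcases hxt with ⟨hhook, rfl⟩ | ⟨hhook, i, hi, rfl⟩
    · cases x with
      | hook p q =>
        refine ⟨⟨c, Sum.inl (p, q)⟩, ?_, rfl⟩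
        simp only [FilledBlock.card] at hx
        simp only [mem_sigma, hc, inl_mem_disjSum, HasAntidiagonal.mem_antidiagonal, true_and]
        omega
      | horizontal m => simp [FilledBlock.isHook] at hhook
      | vertical m => simp [FilledBlock.isHook] at hhook
    · cases x with
      | hook p q => simp [FilledBlock.isHook] at hhook
      | horizontal m =>
        obtain rfl : m = ⟨_, hρ⟩ := PNat.eq hx
        exact ⟨⟨c, Sum.inr (Sum.inl i)⟩, by simp [hc, hi], rfl⟩
      | vertical m =>
        obtain rfl : m = ⟨_, hρ⟩ := PNat.eq hx
        exact ⟨⟨c, Sum.inr (Sum.inr i)⟩, by simp [hc, hi], rfl⟩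

/-- The total number of steps made by each particle. -/
def load {N : ℕ} (ρ : Fin k → ℕ) (φ : Fin k → Fin N) (j : Fin N) : ℕ := ∑ i with φ i = j, ρ i

theorem load_snoc {N : ℕ} (ρ : Fin (k + 1) → ℕ) (φ : Fin k → Fin N) (i j : Fin N) :
    load ρ (Fin.snoc (α := fun _ => Fin N) φ j) i =
      load (fun i => ρ i.castSucc) φ i + if j = i then ρ (Fin.last k) else 0 := by
  rw [load, load, sum_filter, sum_filter, Fin.sum_univ_castSucc]
  simp only [Fin.snoc_castSucc, Fin.snoc_last]

/-- Induction on the number of steps. `A` is general because the inductive hypothesis is applied to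
`raise N m A`, where `m` is the last step; `state_raise` then matches the choices of the last block
in `sum_codes_succ`. -/
theorem sum_load_eq_sum_codes {N : ℕ} (ρ : Fin k → ℕ) (hρ : ∀ i, 0 < ρ i)
    {A : (Fin N → ℕ) → ℤ} (hA : IsAlt A) :
    ∑ φ : Fin k → Fin N, A (fun j => vacuum N j + load ρ φ j) =
      ∑ c ∈ codes ρ, (-1) ^ verticalCount c.1 * state N (fragPairs c.1 c.2) A := by
  induction k generalizing A with
  | zero =>
    have hcodes : codes ρ = {(Fin.elim0, Fin.elim0)} := by
      ext ⟨b, h⟩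
      simp only [mem_codes, mem_singleton]
      exact ⟨fun _ => Subsingleton.elim _ _, fun _ => ⟨fun i => i.elim0, fun i => i.elim0⟩⟩
    rw [hcodes, sum_singleton]
    simp only [univ_unique, load, univ_eq_empty, filter_empty, sum_empty, add_zero, sum_const,
      card_singleton, one_smul]
    have : fragPairs (Fin.elim0 : Fin 0 → FilledBlock) Fin.elim0 = 0 := rfl
    rw [this, state_zero]
    simp [verticalCount]
  | succ k ih =>
    rw [sum_codes_succ ρ (hρ _)]
    -- Summing over the particle that makes the last step is the raising operator.
    have hstep : ∑ φ : Fin (k + 1) → Fin N, A (fun j => vacuum N j + load ρ φ j) =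
        ∑ φ : Fin k → Fin N, raise N (ρ (Fin.last k)) A
          (fun j => vacuum N j + load (fun i => ρ i.castSucc) φ j) := by
      rw [← (Fin.snocEquiv fun _ => Fin N).sum_comp, Fintype.sum_prod_type, sum_comm]
      refine sum_congr rfl fun φ _ => ?_
      simp only [raise, oneBody_apply, Option.elim_some]
      refine sum_congr rfl fun j _ => ?_
      congr 1
      funext i
      change vacuum N i + load ρ (Fin.snoc (α := fun _ => Fin N) φ j) i = _
      rw [load_snoc]
      by_cases hij : i = j
      · subst hij
        simp [add_assoc]
      · simp [Function.update_of_ne hij, Ne.symm hij]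
    rw [hstep, ih _ (fun i => hρ _) (hA.raise _)]
    refine sum_congr rfl fun c _ => ?_
    rw [state_raise (hρ _) _ hA, mul_add, mul_sum, mul_sub]
    congr 1
    · refine sum_congr rfl fun x _ => ?_
      rw [fragPairs_extend_last _ _ rfl, verticalCount_extend]
      simp [FilledBlock.isVertical, numPair, FilledBlock.pNum, FilledBlock.qNum]
    · have h1 : ∀ g : ℕ × ℕ → ℤ, ((fragPairs c.1 c.2).map g).sum =
          ∑ i ∈ hookSet c.1, g (fragPair c.1 c.2 i) := fun g => by
        rw [fragPairs, Multiset.map_map]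
        rfl
      rw [h1, h1, mul_sum, mul_sum, sub_eq_add_neg, ← sum_neg_distrib]
      congr 1
      · refine sum_congr rfl fun i hi => ?_
        rw [fragPairs_extend_castSucc _ _ rfl hi, verticalCount_extend]
        simp [FilledBlock.isVertical, numPair, FilledBlock.pNum, FilledBlock.qNum, Prod.add_def]
      · refine sum_congr rfl fun i hi => ?_
        rw [fragPairs_extend_castSucc _ _ rfl hi, verticalCount_extend]
        simp [FilledBlock.isVertical, numPair, FilledBlock.pNum, FilledBlock.qNum, Prod.add_def,
          pow_succ]

end FilledStructure

/-! ### Filled structures are equivalent to their encodings. -/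

namespace FilledStructure

open Finset

variable {k : ℕ} (T : FilledStructure k)

theorem exists_hookOf (i : Fin k) : ∃ j ∈ T.fragments.part i, (T.block j).isHook = true ∧
    ∀ l ∈ T.fragments.part i, l ≠ j → (T.block l).isHook = false ∧ j < l :=
  T.exists_hook _ (T.fragments.part_mem.2 (mem_univ i))

/-- The hook block of the fragment of the block `i`. -/
noncomputable def hookOf (i : Fin k) : Fin k := (T.exists_hookOf i).choose

theorem hookOf_mem (i : Fin k) : T.hookOf i ∈ T.fragments.part i :=
  (T.exists_hookOf i).choose_spec.1

theorem isHook_hookOf (i : Fin k) : (T.block (T.hookOf i)).isHook = true :=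
  (T.exists_hookOf i).choose_spec.2.1

theorem hookOf_lt {i l : Fin k} (hl : l ∈ T.fragments.part i) (h : l ≠ T.hookOf i) :
    (T.block l).isHook = false ∧ T.hookOf i < l :=
  (T.exists_hookOf i).choose_spec.2.2 l hl h

theorem hookOf_eq_of_mem {i l : Fin k} (hl : l ∈ T.fragments.part i)
    (h : (T.block l).isHook = true) : T.hookOf i = l := by
  by_contra hne
  have := (T.hookOf_lt hl (Ne.symm hne)).1
  simp [h] at this

theorem mem_part_iff {i j : Fin k} : j ∈ T.fragments.part i ↔ T.hookOf j = T.hookOf i := by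
  rw [T.fragments.mem_part_iff_part_eq_part (mem_univ _) (mem_univ _)]
  constructor
  · intro h
    exact T.hookOf_eq_of_mem (by rw [h]; exact T.hookOf_mem i) (T.isHook_hookOf i)
  · intro h
    have h1 := T.hookOf_mem j
    rw [h] at h1
    exact T.fragments.eq_of_mem_parts (T.fragments.part_mem.2 (mem_univ j))
      (T.fragments.part_mem.2 (mem_univ i)) h1 (T.hookOf_mem i)

theorem hookOf_eq_self {i : Fin k} (h : (T.block i).isHook = true) : T.hookOf i = i :=
  T.hookOf_eq_of_mem (T.fragments.mem_part (mem_univ i)) h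

theorem isHookMap_hookOf : IsHookMap T.block T.hookOf := fun i => by
  refine ⟨?_, T.isHook_hookOf i, T.hookOf_eq_self⟩
  by_cases h : i = T.hookOf i
  · exact h.symm.le
  · exact (T.hookOf_lt (T.fragments.mem_part (mem_univ i)) h).2.le

theorem hooks_eq : T.hooks = hookSet T.block := rfl

theorem part_eq_filter {i : Fin k} (hi : i ∈ T.hooks) :
    T.fragments.part i = ({j | T.hookOf j = i} : Finset (Fin k)) := by
  ext j
  rw [mem_part_iff, T.hookOf_eq_self (mem_filter.1 hi).2]
  simp

theorem fragP_part {i : Fin k} (hi : i ∈ T.hooks) :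
    T.fragP (T.fragments.part i) = (fragPair T.block T.hookOf i).1 := by
  rw [fragP, T.part_eq_filter hi, fragPair, Prod.fst_sum]
  rfl

theorem fragQ_part {i : Fin k} (hi : i ∈ T.hooks) :
    T.fragQ (T.fragments.part i) = (fragPair T.block T.hookOf i).2 := by
  rw [fragQ, T.part_eq_filter hi, fragPair, Prod.snd_sum]
  rfl

theorem part_injOn : Set.InjOn T.fragments.part T.hooks := by
  intro i hi j hj h
  have h1 : i ∈ T.fragments.part j := by
    rw [← h]
    exact T.fragments.mem_part (mem_univ i)
  rw [mem_part_iff, T.hookOf_eq_self (mem_filter.1 hi).2,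
    T.hookOf_eq_self (mem_filter.1 hj).2] at h1
  exact h1

theorem parts_eq_image : T.fragments.parts = T.hooks.image T.fragments.part := by
  ext F
  simp only [mem_image]
  constructor
  · intro hF
    obtain ⟨i, hi⟩ := T.fragments.nonempty_of_mem_parts hF
    have hFi := T.fragments.part_eq_of_mem hF hi
    refine ⟨T.hookOf i, mem_filter.2 ⟨mem_univ _, T.isHook_hookOf i⟩, ?_⟩
    exact T.fragments.part_eq_of_mem hF (hFi ▸ T.hookOf_mem i)
  · rintro ⟨i, -, rfl⟩
    exact T.fragments.part_mem.2 (mem_univ i)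

theorem parts_val : T.fragments.parts.val = T.hooks.val.map T.fragments.part := by
  rw [parts_eq_image, image_val_of_injOn T.part_injOn]

theorem pNumbers_eq : T.pNumbers = (fragPairs T.block T.hookOf).map Prod.fst := by
  rw [pNumbers, parts_val, Multiset.map_map, fragPairs, Multiset.map_map]
  exact Multiset.map_congr rfl fun i hi => T.fragP_part (mem_def.2 hi)

theorem qNumbers_eq : T.qNumbers = (fragPairs T.block T.hookOf).map Prod.snd := by
  rw [qNumbers, parts_val, Multiset.map_map, fragPairs, Multiset.map_map]
  exact Multiset.map_congr rfl fun i hi => T.fragQ_part (mem_def.2 hi)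

/-- The sign of the product of the differences of the first and the second components of the
family `x`, over all pairs of indices in `H`. -/
def pairSign {ι : Type*} [LinearOrder ι] (H : Finset ι) (x : ι → ℕ × ℕ) : ℤ :=
  (∏ i ∈ H, ∏ j ∈ H with i < j,
    ((((x i).1 : ℤ) - (x j).1) * (((x i).2 : ℤ) - (x j).2))).sign

theorem sgn_eq : T.sgn = (-1) ^ verticalCount T.block *
    (pairSign (hookSet T.block) (fragPair T.block T.hookOf) *
      (-1) ^ ((fragPairs T.block T.hookOf).map Prod.snd).sum) := by
  have h1 : T.vandermonde.sign = pairSign (hookSet T.block) (fragPair T.block T.hookOf) := by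
    rw [vandermonde, pairSign, hooks_eq]
    congr 1
    refine prod_congr rfl fun i hi => prod_congr rfl fun j hj => ?_
    have hj' : j ∈ T.hooks := (mem_filter.1 hj).1
    rw [T.fragP_part hi, T.fragP_part hj', T.fragQ_part hi, T.fragQ_part hj']
  have h2 : ∑ F ∈ T.fragments.parts, T.fragQ F =
      ((fragPairs T.block T.hookOf).map Prod.snd).sum := by
    rw [← qNumbers_eq]
    rfl
  rw [sgn, h1, h2, pow_add]
  change _ * (_ * (-1) ^ verticalCount T.block) = _
  ring

instance (h : Fin k → Fin k) : DecidableRel (Setoid.ker h) :=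
  fun i j => decidable_of_iff (h i = h j) Iff.rfl

/-- The filled structure with the given blocks and the given map to the hook blocks. -/
noncomputable def ofHookMap (b : Fin k → FilledBlock) (h : Fin k → Fin k) (hbh : IsHookMap b h) :
    FilledStructure k where
  block := b
  fragments := Finpartition.ofSetoid (Setoid.ker h)
  exists_hook F hF := by
    have hidem : ∀ i, h (h i) = h i := fun i => (hbh (h i)).2.2 (hbh i).2.1
    obtain ⟨i, hi⟩ := Finpartition.nonempty_of_mem_parts _ hF
    have hFi := Finpartition.part_eq_of_mem _ hF hi
    have hmem : ∀ j, j ∈ F ↔ h i = h j := fun j => by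
      rw [← hFi, Finpartition.mem_part_ofSetoid_iff_rel, Setoid.ker_def]
    refine ⟨h i, (hmem _).2 (hidem i).symm, (hbh i).2.1, fun j hj hji => ?_⟩
    rw [hmem] at hj
    rw [hj] at hji ⊢
    refine ⟨?_, lt_of_le_of_ne (hbh j).1 (Ne.symm hji)⟩
    by_contra hhook
    exact hji ((hbh j).2.2 (by simpa using hhook)).symm

theorem hookOf_ofHookMap (b : Fin k → FilledBlock) (h : Fin k → Fin k) (hbh : IsHookMap b h) :
    (ofHookMap b h hbh).hookOf = h := by
  funext i
  have hidem : h (h i) = h i := (hbh (h i)).2.2 (hbh i).2.1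
  refine hookOf_eq_of_mem _ ?_ (hbh i).2.1
  change h i ∈ (Finpartition.ofSetoid (Setoid.ker h)).part i
  rw [Finpartition.mem_part_ofSetoid_iff_rel, Setoid.ker_def, hidem]

theorem eq_of_hookOf_eq {T T' : FilledStructure k} (hb : T.block = T'.block)
    (hh : T.hookOf = T'.hookOf) : T = T' := by
  have hpart : ∀ i, T.fragments.part i = T'.fragments.part i := fun i => by
    ext j
    rw [mem_part_iff, mem_part_iff, hh]
  have hf : T.fragments = T'.fragments := by
    ext F
    rw [parts_eq_image, parts_eq_image, hooks_eq, hooks_eq, hb, funext hpart]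
  cases T
  cases T'
  simp only at hb hf
  subst hb hf
  rfl

/-- A filled structure is determined by its blocks and its hook map, every admissible pair occurs,
and all quantities in the sign are expressed through that pair. -/
theorem sum_sgn_eq_sum_codes (μ : YoungDiagram) (ρ : Fin k → ℕ) :
    ∑ T ∈ filledStructures μ ρ, T.sgn = ∑ c ∈ codes ρ, (-1) ^ verticalCount c.1 *
      if (fragPairs c.1 c.2).map Prod.fst = FrobeniusCoord.pCoords μ ∧
        (fragPairs c.1 c.2).map Prod.snd = FrobeniusCoord.qCoords μ then
        pairSign (hookSet c.1) (fragPair c.1 c.2) *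
          (-1) ^ ((fragPairs c.1 c.2).map Prod.snd).sum else 0 := by
  rw [filledStructures, sum_filter]
  refine sum_bij (fun T _ => (T.block, T.hookOf)) ?_ ?_ ?_ ?_
  · intro T hT
    rw [Set.Finite.mem_toFinset] at hT
    exact mem_codes.2 ⟨fun i => congrFun hT i, T.isHookMap_hookOf⟩
  · intro T _ T' _ h
    simp only [Prod.mk.injEq] at h
    exact eq_of_hookOf_eq h.1 h.2
  · rintro ⟨b, h⟩ hc
    rw [mem_codes] at hc
    refine ⟨ofHookMap b h hc.2, ?_, ?_⟩
    · rw [Set.Finite.mem_toFinset]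
      exact funext hc.1
    · rw [hookOf_ofHookMap]
      rfl
  · intro T _
    rw [pNumbers_eq, qNumbers_eq, sgn_eq, mul_ite, mul_zero]

end FilledStructure

/-! ### The sign of an excited configuration. -/

namespace Fermion

open Finset Function FilledStructure

theorem int_sign_prod {ι : Type*} (s : Finset ι) (f : ι → ℤ) :
    (∏ i ∈ s, f i).sign = ∏ i ∈ s, (f i).sign := by
  classical
  induction s using Finset.induction_on with
  | empty => simp
  | insert a s ha ih => rw [prod_insert ha, prod_insert ha, Int.sign_mul, ih]

variable {N : ℕ}

/-- The sign of the permutation sorting the positions into decreasing order. -/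
def orderSign (u : Fin N → ℕ) : ℤ :=
  ∏ p : Fin N × Fin N with p.1 < p.2, ((u p.1 : ℤ) - u p.2).sign

/-- The comparison of the order of two positions with the order in the vacuum. -/
def compareSign (u : Fin N → ℕ) (i j : Fin N) : ℤ :=
  (((u i : ℤ) - u j) * ((j : ℤ) - i)).sign

theorem compareSign_comm (u : Fin N → ℕ) (i j : Fin N) :
    compareSign u i j = compareSign u j i := by
  rw [compareSign, compareSign]
  congr 1
  ring

theorem orderSign_eq (u : Fin N → ℕ) :
    orderSign u = ∏ p : Fin N × Fin N with p.1 < p.2, compareSign u p.1 p.2 := by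
  refine prod_congr rfl fun p hp => ?_
  have hp' : p.1 < p.2 := (mem_filter.1 hp).2
  rw [compareSign, Int.sign_mul, Int.sign_eq_one_of_pos (a := (p.2 : ℤ) - p.1), mul_one]
  rw [Fin.lt_def] at hp'
  omega

/-- The factors of `compareSign` are symmetric in the two particles, so those involving `q` can be
collected regardless of order. -/
theorem orderSign_split (u : Fin N → ℕ) (q : Fin N) :
    orderSign u = (∏ p : Fin N × Fin N with p.1 < p.2 ∧ p.1 ≠ q ∧ p.2 ≠ q,
      compareSign u p.1 p.2) * ∏ j ∈ univ.erase q, compareSign u q j := by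
  rw [orderSign_eq, ← prod_filter_mul_prod_filter_not _ (fun p => p.1 ≠ q ∧ p.2 ≠ q),
    filter_filter]
  congr 1
  symm
  refine prod_bij (fun j _ => if q < j then (q, j) else (j, q)) ?_ ?_ ?_ ?_
  · intro j hj
    have hj' : j ≠ q := (mem_erase.1 hj).1
    split_ifs with h
    · simp [h]
    · simp [lt_of_le_of_ne (not_lt.1 h) hj']
  · intro i hi j hj
    have hi' : i ≠ q := (mem_erase.1 hi).1
    have hj' : j ≠ q := (mem_erase.1 hj).1
    split_ifs <;> simp_all
  · rintro ⟨i, j⟩ hij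
    simp only [mem_filter, mem_univ, true_and, not_and_or, not_not] at hij
    obtain ⟨hlt, rfl | rfl⟩ := hij
    · exact ⟨j, by simp [hlt.ne'], by simp [hlt]⟩
    · exact ⟨i, by simp [hlt.ne], by simp [hlt.le]⟩
  · intro j _
    split_ifs
    · rfl
    · exact compareSign_comm u q j

theorem orderSign_vacuum : orderSign (vacuum N) = 1 := by
  refine prod_eq_one fun p hp => ?_
  have hp' : p.1 < p.2 := (mem_filter.1 hp).2
  have := p.2.2
  rw [Fin.lt_def] at hp'
  apply Int.sign_eq_one_of_pos
  simp only [vacuum]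
  omega

/-- `u` are the positions after exciting the particles at the depths `(x i).2` below the Fermi
level to the heights `(x i).1` above it. -/
structure IsExcited {ι : Type*} (H : Finset ι) (x : ι → ℕ × ℕ) (u : Fin N → ℕ) : Prop where
  injOn : Set.InjOn (fun i => (x i).2) H
  lt : ∀ i ∈ H, (x i).2 < N
  excited : ∀ i ∈ H, ∀ j : Fin N, (x i).2 = j → u j = N + (x i).1
  unexcited : ∀ j : Fin N, (∀ i ∈ H, (x i).2 ≠ j) → u j = vacuum N j

/-- Particle `j` has vacuum depth `j`, so the excited particles are indexed by the second components
of `x`; all other factors are one. -/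
theorem prod_erase_eq_of_excited {ι : Type*} {H : Finset ι} {x : ι → ℕ × ℕ} {u : Fin N → ℕ}
    (hu : IsExcited H x u) {q : Fin N} (hq : ∀ i ∈ H, (x i).2 ≠ q) (F : Fin N → ℤ) (f : ι → ℤ)
    (hF : ∀ i ∈ H, ∀ j : Fin N, (x i).2 = j → F j = f i)
    (hF' : ∀ j, j ≠ q → (∀ i ∈ H, (x i).2 ≠ j) → F j = 1) :
    ∏ j ∈ univ.erase q, F j = ∏ i ∈ H, f i := by
  symm
  refine prod_bij_ne_one (fun i hi _ => (⟨(x i).2, hu.lt i hi⟩ : Fin N)) ?_ ?_ ?_ ?_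
  · intro i hi _
    rw [mem_erase]
    exact ⟨fun h => hq i hi (congrArg Fin.val h), mem_univ _⟩
  · intro i hi _ j hj _ h
    exact hu.injOn hi hj (congrArg Fin.val h)
  · intro j hj hj1
    by_cases h : ∀ i ∈ H, (x i).2 ≠ j
    · exact absurd (hF' j (mem_erase.1 hj).1 h) hj1
    · push Not at h
      obtain ⟨i, hi, hij⟩ := h
      exact ⟨i, hi, by rwa [← hF i hi j hij], Fin.ext hij⟩
  · intro i hi _
    exact (hF i hi _ rfl).symm

theorem prod_sign_sub (q : Fin N) :
    ∏ j ∈ univ.erase q, ((j : ℤ) - q).sign = (-1) ^ (q : ℕ) := by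
  have h : ∀ j ∈ univ.erase q, ((j : ℤ) - q).sign = if j < q then -1 else 1 := fun j hj => by
    have hj' : j ≠ q := (mem_erase.1 hj).1
    rw [Ne, Fin.ext_iff] at hj'
    split_ifs with hlt
    · rw [Fin.lt_def] at hlt
      exact Int.sign_eq_neg_one_of_neg (by omega)
    · rw [Fin.lt_def] at hlt
      exact Int.sign_eq_one_of_pos (by omega)
  rw [prod_congr rfl h, prod_ite, prod_const_one, mul_one, prod_const]
  congr 1
  have : (univ.erase q).filter (fun j => j < q) = Iio q := by
    ext j
    simp only [mem_filter, mem_erase, mem_univ, and_true, mem_Iio, and_iff_right_iff_imp]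
    exact fun h => h.ne
  rw [this, Fin.card_Iio]

/-- Only comparisons with `q` change. Unexcited partners contribute one before the move and `sign (j
- q)` after it. Excited partners contribute `sign (q - q_i)` before and `sign (p - p_i) * sign (q_i
- q)` after. The product of all `sign (j - q)` is `(-1) ^ q`. -/
theorem orderSign_update {ι : Type*} {H : Finset ι} {x : ι → ℕ × ℕ} {u : Fin N → ℕ}
    (hu : IsExcited H x u) {q : Fin N} (hq : ∀ i ∈ H, (x i).2 ≠ q) (p : ℕ) :
    orderSign (update u q (N + p)) = orderSign u *
      (∏ i ∈ H, ((((x i).1 : ℤ) - p) * (((x i).2 : ℤ) - q)).sign) * (-1) ^ (q : ℕ) := by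
  have huq : u q = N - 1 - q := hu.unexcited q hq
  have hqN := q.2
  have hrest : ∏ p' : Fin N × Fin N with p'.1 < p'.2 ∧ p'.1 ≠ q ∧ p'.2 ≠ q,
      compareSign (update u q (N + p)) p'.1 p'.2 =
      ∏ p' : Fin N × Fin N with p'.1 < p'.2 ∧ p'.1 ≠ q ∧ p'.2 ≠ q, compareSign u p'.1 p'.2 := by
    refine prod_congr rfl fun p' hp' => ?_
    have h := (mem_filter.1 hp').2
    rw [compareSign, compareSign, update_of_ne h.2.1, update_of_ne h.2.2]
  have hold : ∏ j ∈ univ.erase q, compareSign u q j = ∏ i ∈ H, ((q : ℤ) - (x i).2).sign := by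
    apply prod_erase_eq_of_excited hu hq
    · intro i hi j hij
      rw [compareSign, hu.excited i hi j hij, huq, Int.sign_mul,
        Int.sign_eq_neg_one_of_neg (by omega), hij, ← neg_sub (j : ℤ) q, Int.sign_neg]
      ring
    · intro j hj h
      have hjN := j.2
      rw [Ne, Fin.ext_iff] at hj
      rw [compareSign, hu.unexcited j h, huq, vacuum]
      have : ((N - 1 - (q : ℕ) : ℕ) : ℤ) - ((N - 1 - (j : ℕ) : ℕ) : ℤ) = (j : ℤ) - q := by omega
      rw [this]
      exact Int.sign_eq_one_of_pos (mul_self_pos.2 (by omega))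
  have hnew : ∏ j ∈ univ.erase q, compareSign (update u q (N + p)) q j =
      (∏ i ∈ H, ((p : ℤ) - (x i).1).sign) * (-1) ^ (q : ℕ) := by
    have h1 : ∀ j ∈ univ.erase q, compareSign (update u q (N + p)) q j =
        (((N + p : ℕ) : ℤ) - u j).sign * ((j : ℤ) - q).sign := fun j hj => by
      rw [compareSign, update_self, update_of_ne (mem_erase.1 hj).1, Int.sign_mul]
    rw [prod_congr rfl h1, prod_mul_distrib, prod_sign_sub]
    congr 1
    apply prod_erase_eq_of_excited hu hq
    · intro i hi j hij
      rw [hu.excited i hi j hij]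
      congr 1
      push_cast
      ring
    · intro j hj h
      rw [hu.unexcited j h, vacuum]
      exact Int.sign_eq_one_of_pos (by omega)
  have hsq : (∏ i ∈ H, ((q : ℤ) - (x i).2).sign) * ∏ i ∈ H, ((q : ℤ) - (x i).2).sign = 1 := by
    rw [← prod_mul_distrib]
    refine prod_eq_one fun i hi => ?_
    rw [← Int.sign_mul]
    exact Int.sign_eq_one_of_pos (mul_self_pos.2 (by have := hq i hi; omega))
  have hprod : ∏ i ∈ H, ((((x i).1 : ℤ) - p) * (((x i).2 : ℤ) - q)).sign =
      (∏ i ∈ H, ((p : ℤ) - (x i).1).sign) * ∏ i ∈ H, ((q : ℤ) - (x i).2).sign := by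
    rw [← prod_mul_distrib]
    refine prod_congr rfl fun i _ => ?_
    rw [← Int.sign_mul]
    congr 1
    ring
  rw [orderSign_split u q, orderSign_split _ q, hrest, hold, hnew, hprod]
  linear_combination (-(∏ p' : Fin N × Fin N with p'.1 < p'.2 ∧ p'.1 ≠ q ∧ p'.2 ≠ q,
    compareSign u p'.1 p'.2) * (∏ i ∈ H, ((p : ℤ) - (x i).1).sign) * (-1) ^ (q : ℕ)) * hsq

theorem pairSign_insert {ι : Type*} [LinearOrder ι] {H : Finset ι} {m : ι} (hm : ∀ i ∈ H, i < m)
    (x : ι → ℕ × ℕ) : pairSign (insert m H) x = pairSign H x *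
      ∏ i ∈ H, ((((x i).1 : ℤ) - (x m).1) * (((x i).2 : ℤ) - (x m).2)).sign := by
  have hmH : m ∉ H := fun h => lt_irrefl _ (hm m h)
  have h1 : ∀ i ∈ H, (insert m H).filter (fun j => i < j) =
      insert m (H.filter fun j => i < j) := fun i hi => by
    rw [filter_insert, if_pos (hm i hi)]
  have h2 : (insert m H).filter (fun j => m < j) = ∅ := by
    rw [filter_eq_empty_iff]
    intro j hj
    rcases mem_insert.1 hj with rfl | hj
    · exact lt_irrefl _
    · exact (hm j hj).not_gt
  rw [pairSign, pairSign, prod_insert hmH, h2, prod_empty, one_mul, ← int_sign_prod, ← Int.sign_mul,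
    ← prod_mul_distrib]
  congr 1
  refine prod_congr rfl fun i hi => ?_
  rw [h1 i hi, prod_insert (by simp [hmH]), mul_comm]

/-- An excitation from depth `q` moves the one particle at `N - 1 - q`, or gives zero if that site
is already emptied or `q ≥ N`. Repeated heights are allowed: both sides of the sign identity are
then zero. -/
theorem state_eq_zero_or_exists {ι : Type*} [LinearOrder ι] (H : Finset ι) (x : ι → ℕ × ℕ) :
    ((¬ Set.InjOn (fun i => (x i).2) H ∨ ∃ i ∈ H, N ≤ (x i).2) ∧
      ∀ A, state N (H.val.map x) A = 0) ∨
    ∃ u : Fin N → ℕ, IsExcited H x u ∧ (∀ A, state N (H.val.map x) A = A u) ∧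
      orderSign u = pairSign H x * (-1) ^ ((H.val.map x).map Prod.snd).sum := by
  -- Adding the largest index makes the new factors of `pairSign` a single product over the old
  -- indices.
  induction H using Finset.induction_on_max with
  | empty =>
    refine Or.inr ⟨vacuum N, ⟨by simp, by simp, by simp, fun _ _ => rfl⟩, fun A => rfl, ?_⟩
    simp [orderSign_vacuum, pairSign]
  | insert m H hm ih =>
    have hmH : m ∉ H := fun h => lt_irrefl _ (hm m h)
    rw [insert_val_of_notMem hmH, Multiset.map_cons]
    rcases ih with ⟨h1, h2⟩ | ⟨u, hu, hA, hs⟩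
    · refine Or.inl ⟨h1.imp (fun h h' => h (h'.mono (by simp))) fun ⟨i, hi, h⟩ =>
        ⟨i, mem_insert_of_mem hi, h⟩, fun A => ?_⟩
      rw [state_cons, h2]
    · by_cases hq : ∃ i ∈ H, (x i).2 = (x m).2
      · obtain ⟨i, hi, him⟩ := hq
        refine Or.inl ⟨Or.inl fun hinj => ?_, fun A => ?_⟩
        · have := hinj (mem_insert_of_mem hi) (mem_insert_self m H) him
          exact hmH (this ▸ hi)
        · rw [state_cons, hA, excite, oneBody_apply]
          refine sum_eq_zero fun j _ => ?_
          rw [if_neg, Option.elim_none]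
          intro hj
          by_cases hex : ∀ i ∈ H, (x i).2 ≠ j
          · rw [hu.unexcited j hex, vacuum] at hj
            exact hex i hi (by rw [him]; omega)
          · push Not at hex
            obtain ⟨i', hi', hij⟩ := hex
            rw [hu.excited i' hi' j hij] at hj
            omega
      · push Not at hq
        by_cases hN : N ≤ (x m).2
        · refine Or.inl ⟨Or.inr ⟨m, mem_insert_self m H, hN⟩, fun A => ?_⟩
          rw [state_cons, hA, excite, oneBody_apply]
          refine sum_eq_zero fun j _ => ?_
          rw [if_neg (by omega), Option.elim_none]
        · push Not at hN
          set q : Fin N := ⟨(x m).2, hN⟩ with hqdef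
          have hq' : ∀ i ∈ H, (x i).2 ≠ q := fun i hi => hq i hi
          refine Or.inr ⟨update u q (N + (x m).1), ⟨?_, ?_, ?_, ?_⟩, fun A => ?_, ?_⟩
          · rw [coe_insert, Set.injOn_insert (by simpa using hmH)]
            refine ⟨hu.injOn, ?_⟩
            rintro ⟨i, hi, h⟩
            exact hq i hi h
          · intro i hi
            rcases mem_insert.1 hi with rfl | hi
            · exact hN
            · exact hu.lt i hi
          · intro i hi j hij
            rcases mem_insert.1 hi with rfl | hi
            · obtain rfl : q = j := Fin.ext hij
              rw [update_self]
            · rw [update_of_ne, hu.excited i hi j hij]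
              rintro rfl
              exact hq' i hi hij
          · intro j hj
            rw [update_of_ne, hu.unexcited j fun i hi => hj i (mem_insert_of_mem hi)]
            rintro rfl
            exact hj m (mem_insert_self m H) rfl
          · rw [state_cons, hA, excite, oneBody_apply, sum_eq_single q]
            · rw [if_pos, Option.elim_some]
              rw [hu.unexcited q hq', vacuum]
              simp only [hqdef]
              omega
            · intro j _ hjq
              rw [if_neg, Option.elim_none]
              intro hj
              by_cases hex : ∀ i ∈ H, (x i).2 ≠ j
              · rw [hu.unexcited j hex, vacuum] at hj
                apply hjq
                ext
                simp only [hqdef]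
                omega
              · push Not at hex
                obtain ⟨i', hi', hij⟩ := hex
                rw [hu.excited i' hi' j hij] at hj
                omega
            · simp
          · rw [orderSign_update hu hq', hs, pairSign_insert hm, Multiset.map_cons,
              Multiset.sum_cons, pow_add]
            simp only [hqdef]
            ring

end Fermion

/-! ### Frobenius coordinates and particle positions -/

namespace FrobeniusCoord

open Finset

theorem mem_diagonal {μ : YoungDiagram} {i : ℕ} : i ∈ diagonal μ ↔ i < μ.rowLen i := by
  rw [diagonal, mem_filter, mem_range, YoungDiagram.mem_iff_lt_rowLen, and_iff_right_iff_imp]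
  exact fun h => (YoungDiagram.lt_card_of_mem (YoungDiagram.mem_iff_lt_rowLen.2 h)).1

theorem mem_diagonal' {μ : YoungDiagram} {i : ℕ} : i ∈ diagonal μ ↔ i < μ.colLen i := by
  rw [mem_diagonal, ← YoungDiagram.mem_iff_lt_rowLen, ← YoungDiagram.mem_iff_lt_colLen]

theorem diagonal_subset (μ : YoungDiagram) : diagonal μ ⊆ range μ.card := filter_subset _ _

theorem diagonal_transpose (μ : YoungDiagram) : diagonal μ.transpose = diagonal μ := by
  ext i
  rw [mem_diagonal, mem_diagonal', YoungDiagram.rowLen_transpose]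

theorem pCoords_transpose (μ : YoungDiagram) : pCoords μ.transpose = qCoords μ := by
  rw [pCoords, qCoords, diagonal_transpose]
  simp only [YoungDiagram.rowLen_transpose]

theorem qCoords_transpose (μ : YoungDiagram) : qCoords μ.transpose = pCoords μ := by
  rw [pCoords, qCoords, diagonal_transpose]
  simp only [YoungDiagram.colLen_transpose]

theorem injOn_qCoord (μ : YoungDiagram) :
    Set.InjOn (fun i => μ.colLen i - (i + 1)) (diagonal μ) := by
  have key : ∀ i ∈ diagonal μ, ∀ j ∈ diagonal μ, i < j →
      μ.colLen j - (j + 1) < μ.colLen i - (i + 1) := fun i hi j hj hij => by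
    have h1 := mem_diagonal'.1 hi
    have h2 := mem_diagonal'.1 hj
    have h3 := μ.colLen_anti i j hij.le
    omega
  intro i hi j hj hij
  dsimp only at hij
  rcases lt_trichotomy i j with h | h | h
  · have := key i hi j hj h
    omega
  · exact h
  · have := key j hj i hi h
    omega

theorem qCoord_lt {μ : YoungDiagram} {i : ℕ} (hi : i ∈ diagonal μ) :
    μ.colLen i - (i + 1) < μ.card := by
  have h1 := mem_diagonal'.1 hi
  have h2 : (μ.colLen i - 1, i) ∈ μ := YoungDiagram.mem_iff_lt_colLen.2 (by omega)
  have := (YoungDiagram.lt_card_of_mem h2).1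
  dsimp only at this
  omega

/-- The depths below the diagonal of the rows without a diagonal cell are the numbers that are not
Frobenius `q`-coordinates. -/
theorem image_sub_rowLen (μ : YoungDiagram) :
    (range μ.card \ diagonal μ).image (fun i => i - μ.rowLen i) =
      range μ.card \ (diagonal μ).image (fun i => μ.colLen i - (i + 1)) := by
  have hle : ∀ i ∈ range μ.card \ diagonal μ, μ.rowLen i ≤ i := fun i hi => by
    have := (mem_sdiff.1 hi).2
    rw [mem_diagonal] at this
    omega
  apply eq_of_subset_of_card_le
  · intro y hy
    obtain ⟨i, hi, rfl⟩ := mem_image.1 hy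
    have hi1 := hle i hi
    have hi2 := mem_range.1 (mem_sdiff.1 hi).1
    rw [mem_sdiff, mem_range]
    refine ⟨by omega, fun h => ?_⟩
    obtain ⟨j, hj, hij⟩ := mem_image.1 h
    have hj1 := mem_diagonal'.1 hj
    -- Equality would mean `rowLen i + colLen j = i + j + 1`, but the left side is at least `i + j +
    -- 2` when `(i, j)` is a cell and at most `i + j` when it is not.
    by_cases hmem : (i, j) ∈ μ
    · have h1 := YoungDiagram.mem_iff_lt_rowLen.1 hmem
      have h2 := YoungDiagram.mem_iff_lt_colLen.1 hmem
      omega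
    · have h1 := hmem
      rw [YoungDiagram.mem_iff_lt_rowLen] at h1
      rw [YoungDiagram.mem_iff_lt_colLen] at hmem
      omega
  · have hinj : Set.InjOn (fun i => i - μ.rowLen i) (range μ.card \ diagonal μ : Finset ℕ) := by
      intro i hi j hj hij
      have hi1 := hle i hi
      have hj1 := hle j hj
      dsimp only at hij
      rcases le_total i j with h | h
      · have := μ.rowLen_anti i j h
        omega
      · have := μ.rowLen_anti j i h
        omega
    rw [card_image_of_injOn hinj, card_sdiff_of_subset (diagonal_subset μ), card_sdiff_of_subset,
      card_image_of_injOn (injOn_qCoord μ)]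
    intro y hy
    obtain ⟨i, hi, rfl⟩ := mem_image.1 hy
    exact mem_range.2 (qCoord_lt hi)

end FrobeniusCoord

/-! ### Matching excited configurations with Young diagrams. -/

namespace Fermion

open Finset Function FrobeniusCoord

theorem map_univ_fin {N : ℕ} (f : ℕ → ℕ) :
    (univ : Finset (Fin N)).val.map (fun i : Fin N => f i) = (range N).val.map f := by
  have : range N = (univ : Finset (Fin N)).map Fin.valEmbedding := by
    ext i
    simp only [mem_range, mem_map, mem_univ, true_and, Fin.valEmbedding_apply]
    exact ⟨fun h => ⟨⟨i, h⟩, rfl⟩, by rintro ⟨j, rfl⟩; exact j.2⟩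
  rw [this, map_val, Multiset.map_map]
  rfl

theorem val_add_val_sdiff {s t : Finset ℕ} (h : s ⊆ t) : t.val = s.val + (t \ s).val := by
  rw [← disjUnion_val _ _ disjoint_sdiff, disjUnion_eq_union, union_sdiff_of_subset h]

theorem IsExcited.map_eq {ι : Type*} {N : ℕ} {H : Finset ι} {x : ι → ℕ × ℕ} {u : Fin N → ℕ}
    (hu : IsExcited H x u) : univ.val.map u = H.val.map (fun i => N + (x i).1) +
      (range N \ H.image fun i => (x i).2).val.map fun j => N - 1 - j := by
  let v : ℕ → ℕ := fun j => if h : j < N then u ⟨j, h⟩ else 0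
  have h1 : u = fun i : Fin N => v i := by
    funext i
    simp [v]
  have hsub : H.image (fun i => (x i).2) ⊆ range N := fun y hy => by
    obtain ⟨i, hi, rfl⟩ := mem_image.1 hy
    exact mem_range.2 (hu.lt i hi)
  conv_lhs => rw [h1]
  rw [map_univ_fin, val_add_val_sdiff hsub, Multiset.map_add, image_val_of_injOn hu.injOn,
    Multiset.map_map]
  congr 1
  · refine Multiset.map_congr rfl fun i hi => ?_
    have hi' : i ∈ H := hi
    simp only [comp_apply, v]
    rw [dif_pos (hu.lt i hi'), hu.excited i hi' _ rfl]
  · refine Multiset.map_congr rfl fun j hj => ?_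
    have hj' := mem_sdiff.1 (mem_def.2 hj)
    simp only [v]
    rw [dif_pos (mem_range.1 hj'.1), hu.unexcited]
    · rfl
    · intro i hi h
      exact hj'.2 (mem_image.2 ⟨i, hi, h⟩)

/-- The particle positions of a Young diagram. -/
def positions (n : ℕ) (μ : YoungDiagram) (i : Fin n) : ℕ := μ.rowLen i + vacuum n i

/-- Rows with a diagonal cell lie above the level at the heights `p_i`; by `image_sub_rowLen` the
remaining rows occupy exactly the depths that are not `q`-coordinates. -/
theorem map_positions (μ : YoungDiagram) : univ.val.map (positions μ.card μ) =
    (pCoords μ).map (fun p => μ.card + p) +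
      (range μ.card \ (diagonal μ).image fun i => μ.colLen i - (i + 1)).val.map
        fun j => μ.card - 1 - j := by
  change univ.val.map (fun i : Fin μ.card => μ.rowLen i + (μ.card - 1 - i)) = _
  rw [map_univ_fin (fun i => μ.rowLen i + (μ.card - 1 - i)),
    val_add_val_sdiff (diagonal_subset μ), Multiset.map_add, pCoords, Multiset.map_map]
  congr 1
  · refine Multiset.map_congr rfl fun i hi => ?_
    have h1 := mem_diagonal.1 (mem_def.2 hi)
    have h2 := mem_range.1 (diagonal_subset μ (mem_def.2 hi))
    simp only [comp_apply]
    omega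
  · rw [← image_sub_rowLen, image_val_of_injOn, Multiset.map_map]
    · refine Multiset.map_congr rfl fun i hi => ?_
      have hi' := mem_sdiff.1 (mem_def.2 hi)
      have h1 := mem_range.1 hi'.1
      have h2 := hi'.2
      rw [mem_diagonal] at h2
      simp only [comp_apply]
      omega
    · intro i hi j hj hij
      have hi' := (mem_sdiff.1 hi).2
      have hj' := (mem_sdiff.1 hj).2
      rw [mem_diagonal] at hi' hj'
      dsimp only at hij
      rcases le_total i j with h | h
      · have := μ.rowLen_anti i j h
        omega
      · have := μ.rowLen_anti j i h
        omega

/-- The values at least `N` recover the first multiset, and those below `N` the second. -/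
theorem eq_of_add_eq_add_level {N : ℕ} {s s' : Multiset ℕ} {C C' : Finset ℕ} (hC : C ⊆ range N)
    (hC' : C' ⊆ range N)
    (h : s.map (fun p => N + p) + C.val.map (fun j => N - 1 - j) =
      s'.map (fun p => N + p) + C'.val.map (fun j => N - 1 - j)) : s = s' ∧ C = C' := by
  have hhigh : ∀ s : Multiset ℕ, (s.map fun p => N + p).filter (fun v => N ≤ v) =
      s.map fun p => N + p := fun s => by
    rw [Multiset.filter_eq_self]
    intro a ha
    obtain ⟨p, -, rfl⟩ := Multiset.mem_map.1 ha
    omega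
  have hhigh' : ∀ s : Multiset ℕ, (s.map fun p => N + p).filter (fun v => ¬ N ≤ v) = 0 := fun s => by
    rw [Multiset.filter_eq_nil]
    intro a ha
    obtain ⟨p, -, rfl⟩ := Multiset.mem_map.1 ha
    omega
  have hlow : ∀ C ⊆ range N, (C.val.map fun j => N - 1 - j).filter (fun v => N ≤ v) = 0 := by
    intro C hC
    rw [Multiset.filter_eq_nil]
    intro a ha
    obtain ⟨p, hp, rfl⟩ := Multiset.mem_map.1 ha
    have := mem_range.1 (hC (mem_def.2 hp))
    omega
  have hlow' : ∀ C ⊆ range N, (C.val.map fun j => N - 1 - j).filter (fun v => ¬ N ≤ v) =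
      C.val.map fun j => N - 1 - j := by
    intro C hC
    rw [Multiset.filter_eq_self]
    intro a ha
    obtain ⟨p, hp, rfl⟩ := Multiset.mem_map.1 ha
    have := mem_range.1 (hC (mem_def.2 hp))
    omega
  constructor
  · have h1 := congrArg (Multiset.filter fun v => N ≤ v) h
    rw [Multiset.filter_add, Multiset.filter_add, hhigh, hhigh, hlow C hC, hlow C' hC', add_zero,
      add_zero] at h1
    exact Multiset.map_injective (fun a b hab => Nat.add_left_cancel hab) h1
  · have h1 := congrArg (Multiset.filter fun v => ¬ N ≤ v) h
    rw [Multiset.filter_add, Multiset.filter_add, hhigh', hhigh', hlow' C hC, hlow' C' hC',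
      zero_add, zero_add] at h1
    have hinv : ∀ C ⊆ range N, (C.val.map fun j => N - 1 - j).map (fun j => N - 1 - j) = C.val := by
      intro C hC
      rw [Multiset.map_map]
      conv_rhs => rw [← Multiset.map_id C.val]
      refine Multiset.map_congr rfl fun j hj => ?_
      have := mem_range.1 (hC (mem_def.2 hj))
      simp only [comp_apply, id]
      omega
    rw [← val_inj, ← hinv C hC, h1, hinv C' hC']

theorem IsExcited.map_eq_map_positions_iff {ι : Type*} {μ : YoungDiagram} {H : Finset ι}
    {x : ι → ℕ × ℕ} {u : Fin μ.card → ℕ} (hu : IsExcited H x u) :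
    univ.val.map u = univ.val.map (positions μ.card μ) ↔
      (H.val.map x).map Prod.fst = pCoords μ ∧ (H.val.map x).map Prod.snd = qCoords μ := by
  have h1 : (H.val.map fun i => μ.card + (x i).1) =
      ((H.val.map x).map Prod.fst).map fun p => μ.card + p := by
    rw [Multiset.map_map, Multiset.map_map]
    rfl
  have h2 : (H.val.map x).map Prod.snd = (H.image fun i => (x i).2).val := by
    rw [image_val_of_injOn hu.injOn, Multiset.map_map]
    rfl
  have h3 : qCoords μ = ((diagonal μ).image fun i => μ.colLen i - (i + 1)).val := by
    rw [image_val_of_injOn (injOn_qCoord μ)]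
    rfl
  have hsub : H.image (fun i => (x i).2) ⊆ range μ.card := fun y hy => by
    obtain ⟨i, hi, rfl⟩ := mem_image.1 hy
    exact mem_range.2 (hu.lt i hi)
  have hsub' : (diagonal μ).image (fun i => μ.colLen i - (i + 1)) ⊆ range μ.card := fun y hy => by
    obtain ⟨i, hi, rfl⟩ := mem_image.1 hy
    exact mem_range.2 (qCoord_lt hi)
  rw [hu.map_eq, map_positions, h1, h2, h3]
  constructor
  · intro h
    obtain ⟨hs, hC⟩ := eq_of_add_eq_add_level sdiff_subset sdiff_subset h
    refine ⟨hs, ?_⟩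
    rw [← Finset.sdiff_sdiff_eq_self hsub, hC, Finset.sdiff_sdiff_eq_self hsub']
  · rintro ⟨hs, hQ⟩
    rw [hs, val_inj.1 hQ]

end Fermion

/-! ### The antisymmetrized indicator and the two forms of the step sum. -/

namespace Fermion

open Finset Function Equiv FrobeniusCoord FilledStructure

variable {N : ℕ}

/-- The antisymmetrized indicator function of `a`. -/
def antisymm (a u : Fin N → ℕ) : ℤ :=
  ∑ w : Perm (Fin N), (Perm.sign w : ℤ) * if ∀ i, u (w i) = a i then 1 else 0

theorem isAlt_antisymm (a : Fin N → ℕ) : IsAlt (antisymm a) := by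
  intro u σ
  rw [antisymm, antisymm, mul_sum]
  refine sum_equiv (Equiv.mulLeft σ) (by simp) fun w _ => ?_
  have hs : (Perm.sign σ : ℤ) * (Perm.sign σ : ℤ) = 1 := by
    rw [← Units.val_mul, Int.units_mul_self, Units.val_one]
  simp only [coe_mulLeft, Perm.mul_apply, Perm.sign_mul, Units.val_mul, comp_apply]
  rw [← mul_assoc, ← mul_assoc, hs, one_mul]
  congr

/-- The Vandermonde determinant supplies the antisymmetry of `orderSign`. The positions are negated
because its factors are later minus earlier entries. -/
theorem orderSign_eq_sign_det (u : Fin N → ℕ) :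
    orderSign u = (Matrix.vandermonde fun i => -(u i : ℤ)).det.sign := by
  rw [Matrix.det_vandermonde, int_sign_prod, orderSign, prod_filter, ← univ_product_univ,
    prod_product]
  refine prod_congr rfl fun i _ => ?_
  rw [int_sign_prod, ← prod_filter]
  refine prod_congr (by ext; simp) fun j _ => ?_
  congr 1
  ring

theorem isAlt_orderSign : IsAlt (orderSign (N := N)) := by
  intro u σ
  have h : (Matrix.vandermonde fun i => -((u ∘ σ) i : ℤ)) =
      (Matrix.vandermonde fun i => -(u i : ℤ)).submatrix σ id := by
    ext i j
    simp [Matrix.vandermonde_apply]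
  have hs : ((Perm.sign σ : ℤ)).sign = (Perm.sign σ : ℤ) := by
    rcases Int.units_eq_one_or (Perm.sign σ) with h | h <;> simp [h]
  rw [orderSign_eq_sign_det, orderSign_eq_sign_det, h, Matrix.det_permute, Int.sign_mul]
  simp only [Int.cast_id, hs]

theorem orderSign_of_strictAnti {a : Fin N → ℕ} (ha : StrictAnti a) : orderSign a = 1 := by
  refine prod_eq_one fun p hp => Int.sign_eq_one_of_pos ?_
  have := ha (mem_filter.1 hp).2
  omega

theorem antisymm_eq {a : Fin N → ℕ} (ha : StrictAnti a) (u : Fin N → ℕ) :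
    antisymm a u = if univ.val.map u = univ.val.map a then orderSign u else 0 := by
  split_ifs with h
  · obtain ⟨w, hw⟩ : ∃ w : Perm (Fin N), u ∘ w = a := by
      refine SpechtChar.exists_perm_comp_eq fun i => ?_
      have h1 := congrArg (Multiset.count i) h
      rw [Multiset.count_map, Multiset.count_map] at h1
      simp only [Finset.card, filter_val]
      simpa only [eq_comm] using h1
    have hinj : Injective u := by
      have : u = a ∘ w.symm := by
        rw [← hw]
        funext i
        simp
      rw [this]
      exact ha.injective.comp w.symm.injective
    rw [antisymm, sum_eq_single w]
    · rw [if_pos (show ∀ i, u (w i) = a i from congrFun hw), mul_one]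
      have h1 := isAlt_orderSign u w
      rw [hw, orderSign_of_strictAnti ha] at h1
      have hs : (Perm.sign w : ℤ) * (Perm.sign w : ℤ) = 1 := by
        rw [← Units.val_mul, Int.units_mul_self, Units.val_one]
      linear_combination (Perm.sign w : ℤ) * h1 + orderSign u * hs
    · intro v _ hv
      rw [if_neg, mul_zero]
      intro h'
      apply hv
      ext i
      rw [hinj ((h' i).trans (congrFun hw i).symm)]
    · simp
  · rw [antisymm]
    refine sum_eq_zero fun w _ => ?_
    rw [if_neg, mul_zero]
    intro h'
    apply h
    have : a = u ∘ w := funext fun i => (h' i).symm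
    rw [this, ← Multiset.map_map]
    congr 1
    have := congrArg Finset.val (map_univ_equiv w)
    rw [map_val] at this
    exact this.symm

theorem strictAnti_positions (n : ℕ) (μ : YoungDiagram) : StrictAnti (positions n μ) := by
  intro i j hij
  rw [Fin.lt_def] at hij
  have h1 := μ.rowLen_anti i j hij.le
  have := j.2
  simp only [positions, vacuum]
  omega

/-- In the vanishing case the condition on the right fails too, since the `q`-coordinates are
distinct and smaller than `μ.card`. -/
theorem state_antisymm {ι : Type*} [LinearOrder ι] (μ : YoungDiagram) (H : Finset ι)
    (x : ι → ℕ × ℕ) : state μ.card (H.val.map x) (antisymm (positions μ.card μ)) =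
      if (H.val.map x).map Prod.fst = pCoords μ ∧ (H.val.map x).map Prod.snd = qCoords μ then
        pairSign H x * (-1) ^ ((H.val.map x).map Prod.snd).sum else 0 := by
  rcases state_eq_zero_or_exists (N := μ.card) H x with ⟨h1, h2⟩ | ⟨u, hu, hA, hs⟩
  · rw [h2, if_neg]
    rintro ⟨-, hQ⟩
    have hQ' : H.val.map (fun i => (x i).2) = qCoords μ := by
      rw [← hQ, Multiset.map_map]
      rfl
    rcases h1 with h1 | ⟨i, hi, h1⟩
    · apply h1
      have hnodup : (H.val.map fun i => (x i).2).Nodup := by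
        rw [hQ', qCoords]
        exact Multiset.Nodup.map_on (fun i hi j hj h => injOn_qCoord μ hi hj h) (diagonal μ).nodup
      intro i hi j hj hij
      exact Multiset.inj_on_of_nodup_map hnodup i hi j hj hij
    · have hmem : (x i).2 ∈ qCoords μ := by
        rw [← hQ']
        exact Multiset.mem_map_of_mem (fun i => (x i).2) hi
      obtain ⟨j, hj, hij⟩ := Multiset.mem_map.1 hmem
      have := qCoord_lt (mem_def.2 hj)
      omega
  · rw [hA, antisymm_eq (strictAnti_positions _ μ), hs]
    simp only [hu.map_eq_map_positions_iff]

/-- The sum of the signs of the filled structures as a sum over the assignments of steps to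
particles. -/
theorem sum_sgn_eq_sum_load {k : ℕ} (μ : YoungDiagram) (ρ : Fin k → ℕ) (hρ : ∀ i, 0 < ρ i) :
    ∑ T ∈ filledStructures μ ρ, T.sgn = ∑ φ : Fin k → Fin μ.card,
      antisymm (positions μ.card μ) (fun j => vacuum μ.card j + load ρ φ j) := by
  rw [sum_load_eq_sum_codes ρ hρ (isAlt_antisymm _), sum_sgn_eq_sum_codes]
  refine sum_congr rfl fun c _ => ?_
  rw [fragPairs, state_antisymm]

theorem sum_load_eq_sum_perm {n k : ℕ} (μ : YoungDiagram) (ρ : Fin k → ℕ) :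
    ∑ φ : Fin k → Fin n, antisymm (positions n μ) (fun j => vacuum n j + load ρ φ j) =
      ∑ w : Perm (Fin n), (Perm.sign w : ℤ) *
        #{φ : Fin k → Fin n | ∀ i, load ρ φ i + (i : ℕ) = μ.rowLen i + w i} := by
  simp only [antisymm]
  rw [sum_comm]
  refine sum_congr rfl fun w _ => ?_
  rw [← mul_sum, card_filter, Nat.cast_sum]
  congr 1
  symm
  -- Relabelling the particles by `w` moves the permutation from the load to the target; the common
  -- `n - 1` of the vacuum positions cancels.
  refine sum_equiv (Equiv.arrowCongr (Equiv.refl _) w) (by simp) fun φ _ => ?_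
  have hload : ∀ i, load ρ (Equiv.arrowCongr (Equiv.refl _) w φ) (w i) = load ρ φ i := fun i => by
    simp [load, Equiv.arrowCongr]
  simp only [hload, Nat.cast_ite, Nat.cast_one, Nat.cast_zero]
  congr 1
  refine propext (forall_congr' fun i => ?_)
  have h1 := i.2
  have h2 := (w i).2
  simp only [positions, vacuum]
  omega

end Fermion

/-! ### Colourings fixed by a permutation -/

namespace SpechtChar

open Equiv Finset Function FilledStructure

theorem exists_equiv_comp_eq {X X' Y : Type*} [Fintype X] [Fintype X'] [DecidableEq Y] {f : X → Y}
    {g : X' → Y} (h : univ.val.map f = univ.val.map g) : ∃ e : X ≃ X', g ∘ e = f := by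
  have h' : ∀ i, Nonempty ({x // f x = i} ≃ {x // g x = i}) := fun i => by
    have h1 := congrArg (Multiset.count i) h
    rw [Multiset.count_map, Multiset.count_map] at h1
    rw [← Fintype.card_eq, Fintype.card_subtype, Fintype.card_subtype]
    simp only [Finset.card, filter_val]
    simpa only [eq_comm] using h1
  exact ⟨Equiv.ofFiberEquiv fun i => (h' i).some, funext fun x => Equiv.ofFiberEquiv_map _ x⟩

variable {n k : ℕ}

/-- The cycles of a permutation, fixed points included. -/
abbrev Cycles (g : Perm (Fin n)) : Type := {c // c ∈ g.cycleFactorsFinset} ⊕ {x // g x = x}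

/-- The length of a cycle. -/
def cycleLength (g : Perm (Fin n)) : Cycles g → ℕ := Sum.elim (fun c => #c.1.support) fun _ => 1

theorem map_cycleLength (g : Perm (Fin n)) :
    univ.val.map (cycleLength g) = g.partition.parts := by
  rw [Perm.parts_partition, ← univ_disjSum_univ, val_disjSum, Multiset.disjSum, Multiset.map_add,
    Multiset.map_map, Multiset.map_map]
  congr 1
  · change (univ : Finset {c // c ∈ g.cycleFactorsFinset}).val.map
      (fun c : {c // c ∈ g.cycleFactorsFinset} => #c.1.support) = _
    rw [Perm.cycleType_def, univ_eq_attach, attach_val]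
    exact Multiset.attach_map_val' g.cycleFactorsFinset.val fun c => #c.support
  · change (univ : Finset {x // g x = x}).val.map (fun _ => 1) = _
    rw [Multiset.map_const']
    congr 1
    change Fintype.card {x // g x = x} = _
    rw [Fintype.card_subtype, ← card_compl]
    congr 1
    ext x
    simp

/-- The cycle of a point. -/
def cycleClass (g : Perm (Fin n)) (x : Fin n) : Cycles g :=
  if h : g x = x then Sum.inr ⟨x, h⟩
  else Sum.inl ⟨g.cycleOf x, Perm.cycleOf_mem_cycleFactorsFinset_iff.2 (Perm.mem_support.2 h)⟩

theorem cycleClass_apply (g : Perm (Fin n)) (x : Fin n) :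
    cycleClass g (g x) = cycleClass g x := by
  by_cases h : g x = x
  · rw [h]
  · have h' : ¬ g (g x) = g x := fun h' => h (g.injective h')
    simp only [cycleClass, dif_neg h, dif_neg h', Perm.cycleOf_self_apply]

theorem sameCycle_of_cycleClass_eq {g : Perm (Fin n)} {x y : Fin n}
    (h : cycleClass g x = cycleClass g y) : g.SameCycle x y := by
  by_cases hx : g x = x <;> by_cases hy : g y = y
  · simp only [cycleClass, dif_pos hx, dif_pos hy, Sum.inr.injEq, Subtype.mk.injEq] at h
    rw [h]
  · simp [cycleClass, hx, hy] at h
  · simp [cycleClass, hx, hy] at h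
  · simp only [cycleClass, dif_neg hx, dif_neg hy, Sum.inl.injEq, Subtype.mk.injEq] at h
    have : y ∈ (g.cycleOf x).support := by
      rw [h, Perm.mem_support_cycleOf_iff]
      exact ⟨Perm.SameCycle.refl g y, Perm.mem_support.2 hy⟩
    exact (Perm.mem_support_cycleOf_iff.1 this).1

theorem card_cycleClass (g : Perm (Fin n)) (c : Cycles g) :
    #{x | cycleClass g x = c} = cycleLength g c := by
  rcases c with ⟨c, hc⟩ | ⟨y, hy⟩
  · change _ = #c.support
    congr 1
    ext x
    simp only [mem_filter, mem_univ, true_and]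
    by_cases hx : g x = x
    · simp only [cycleClass, dif_pos hx, reduceCtorEq, false_iff]
      intro h
      exact Perm.mem_support.1 (Perm.mem_cycleFactorsFinset_support_le hc h) hx
    · simp only [cycleClass, dif_neg hx, Sum.inl.injEq, Subtype.mk.injEq]
      constructor
      · rintro rfl
        rw [Perm.mem_support_cycleOf_iff]
        exact ⟨Perm.SameCycle.refl g x, Perm.mem_support.2 hx⟩
      · intro h
        exact (Perm.cycle_is_cycleOf h hc).symm
  · change _ = 1
    rw [card_eq_one]
    refine ⟨y, ?_⟩
    ext x
    simp only [mem_filter, mem_univ, true_and, mem_singleton]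
    by_cases hx : g x = x
    · simp [cycleClass, hx]
    · simp only [cycleClass, dif_neg hx, reduceCtorEq, false_iff]
      rintro rfl
      exact hx hy

/-- The numbering of the cycles of `g` by the indices of the sequence of their lengths. -/
theorem exists_cycle_numbering {g : Perm (Fin n)} {ρ : Fin k → ℕ}
    (hg : g.partition.parts = (univ : Finset (Fin k)).val.map ρ) :
    ∃ cyc : Fin n → Fin k, (∀ x, cyc (g x) = cyc x) ∧
      (∀ x y, cyc x = cyc y → g.SameCycle x y) ∧ ∀ i, #{x | cyc x = i} = ρ i := by
  obtain ⟨e, he⟩ := exists_equiv_comp_eq ((map_cycleLength g).trans hg)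
  refine ⟨fun x => e (cycleClass g x), fun x => by simp only [cycleClass_apply], fun x y h =>
    sameCycle_of_cycleClass_eq (e.injective h), fun i => ?_⟩
  obtain ⟨c, rfl⟩ := e.surjective i
  simp only [EmbeddingLike.apply_eq_iff_eq]
  rw [card_cycleClass, ← he]
  rfl

theorem pos_of_parts_eq {g : Perm (Fin n)} {ρ : Fin k → ℕ}
    (hg : g.partition.parts = (univ : Finset (Fin k)).val.map ρ) (i : Fin k) : 0 < ρ i := by
  apply g.partition.parts_pos
  rw [hg]
  exact Multiset.mem_map_of_mem ρ (mem_univ i)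

theorem eq_of_sameCycle {Y : Type*} {g : Perm (Fin n)} {f : Fin n → Y} (hf : ∀ x, f (g x) = f x)
    {x y : Fin n} (h : g.SameCycle x y) : f x = f y := by
  obtain ⟨m, -, rfl⟩ := h.exists_pow_eq'
  clear h
  induction m with
  | zero => simp
  | succ m ih => rw [pow_succ', Perm.mul_apply, hf, ih]

/-- A colouring fixed by `g` is constant on cycles, hence is an assignment of colours to the indices
of `ρ`; each colour class has size equal to the load. -/
theorem jacobiTrudi_eq_sum_load (μ : YoungDiagram) {g : Perm (Fin n)} {ρ : Fin k → ℕ}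
    (hg : g.partition.parts = (univ : Finset (Fin k)).val.map ρ) :
    jacobiTrudi μ g = ∑ w : Perm (Fin n), (Perm.sign w : ℤ) *
      #{φ : Fin k → Fin n | ∀ i, load ρ φ i + (i : ℕ) = μ.rowLen i + w i} := by
  obtain ⟨cyc, hcyc, hsame, hcard⟩ := exists_cycle_numbering hg
  have hsurj : Surjective cyc := fun i => by
    have : 0 < #{x | cyc x = i} := by
      rw [hcard]
      exact pos_of_parts_eq hg i
    obtain ⟨x, hx⟩ := card_pos.1 this
    exact ⟨x, (mem_filter.1 hx).2⟩
  have hload : ∀ (φ : Fin k → Fin n) (i : Fin n), #{x | φ (cyc x) = i} = load ρ φ i := by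
    intro φ i
    rw [load, card_eq_sum_card_fiberwise (f := cyc) (t := {j | φ j = i})]
    · refine sum_congr rfl fun j hj => ?_
      rw [← hcard j, filter_filter]
      congr 1
      ext x
      simp only [mem_filter, mem_univ, true_and] at hj ⊢
      constructor
      · exact fun h => h.2
      · rintro rfl
        exact ⟨hj, rfl⟩
    · intro x hx
      simpa using hx
  rw [jacobiTrudi]
  refine sum_congr rfl fun w _ => ?_
  congr 2
  symm
  refine card_bij (fun φ _ => φ ∘ cyc) ?_ ?_ ?_
  · intro φ hφ
    simp only [mem_filter, mem_univ, true_and] at hφ ⊢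
    refine ⟨fun x => by simp [hcyc], fun i => ?_⟩
    rw [← hφ i, ← hload]
    rfl
  · intro φ _ ψ _ h
    exact hsurj.injective_comp_right h
  · intro f hf
    simp only [mem_filter, mem_univ, true_and] at hf
    let φ : Fin k → Fin n := fun i => f (surjInv hsurj i)
    have hφ : φ ∘ cyc = f := by
      funext x
      exact eq_of_sameCycle hf.1 (hsame _ _ (surjInv_eq hsurj (cyc x)))
    refine ⟨φ, ?_, hφ⟩
    simp only [mem_filter, mem_univ, true_and]
    intro i
    rw [← hload, ← hf.2 i, ← hφ]
    rfl

/-- The Jacobi–Trudi combination is the sum of the signs of the filled structures. -/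
theorem jacobiTrudi_eq_sum_sgn {μ : YoungDiagram} (hμ : μ.card = n) {g : Perm (Fin n)}
    {ρ : Fin k → ℕ} (hg : g.partition.parts = (univ : Finset (Fin k)).val.map ρ) :
    jacobiTrudi μ g = ∑ T ∈ filledStructures μ ρ, T.sgn := by
  subst hμ
  rw [jacobiTrudi_eq_sum_load μ hg, Fermion.sum_sgn_eq_sum_load μ ρ (pos_of_parts_eq hg),
    Fermion.sum_load_eq_sum_perm]

theorem sign_eq_of_parts_eq {g : Perm (Fin n)} {ρ : Fin k → ℕ}
    (hg : g.partition.parts = (univ : Finset (Fin k)).val.map ρ) :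
    (Perm.sign g : ℤ) = (-1) ^ (k + ∑ i, ρ i) := by
  have h1 : Perm.sign g = (g.partition.parts.map fun m => -(-1 : ℤˣ) ^ m).prod := by
    rw [Perm.sign_of_cycleType', Perm.parts_partition, Multiset.map_add, Multiset.prod_add]
    simp
  have h2 : Perm.sign g = ∏ i : Fin k, -(-1 : ℤˣ) ^ ρ i := by
    rw [h1, hg, Multiset.map_map]
    rfl
  have h3 : ∀ m : ℕ, -(-1 : ℤˣ) ^ m = (-1) * (-1) ^ m := fun m => by rw [neg_one_mul]
  rw [h2]
  simp only [h3, prod_mul_distrib, prod_const, card_univ, Fintype.card_fin, prod_pow_eq_pow_sum]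
  rw [← pow_add]
  simp

theorem exists_parts_eq (g : Perm (Fin n)) :
    ∃ (k : ℕ) (ρ : Fin k → ℕ), g.partition.parts = (univ : Finset (Fin k)).val.map ρ := by
  refine ⟨g.partition.parts.toList.length, g.partition.parts.toList.get, ?_⟩
  rw [Fin.univ_val_map, List.ofFn_get, Multiset.coe_toList]

end SpechtChar

/-! ### Transposition of filled structures. -/

namespace FilledBlock

/-- The transposed block. -/
def transpose : FilledBlock → FilledBlock
  | hook p q => hook q p
  | horizontal m => vertical m
  | vertical m => horizontal m

theorem transpose_transpose (b : FilledBlock) : b.transpose.transpose = b := by cases b <;> rfl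

theorem card_transpose (b : FilledBlock) : b.transpose.card = b.card := by
  cases b <;> simp only [transpose, card]
  ring

theorem isHook_transpose (b : FilledBlock) : b.transpose.isHook = b.isHook := by cases b <;> rfl

end FilledBlock

namespace FilledStructure

open Finset

variable {k : ℕ}

theorem numPair_transpose (b : FilledBlock) : numPair b.transpose = (numPair b).swap := by
  cases b <;> rfl

theorem hookSet_transpose (b : Fin k → FilledBlock) :
    hookSet (fun i => (b i).transpose) = hookSet b := by
  simp only [hookSet, FilledBlock.isHook_transpose]

theorem fragPair_transpose (b : Fin k → FilledBlock) (h : Fin k → Fin k) :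
    fragPair (fun i => (b i).transpose) h = fun i => (fragPair b h i).swap := by
  funext i
  simp only [fragPair, numPair_transpose]
  ext <;> simp [Prod.fst_sum, Prod.snd_sum]

theorem isHookMap_transpose {b : Fin k → FilledBlock} {h : Fin k → Fin k} :
    IsHookMap (fun i => (b i).transpose) h ↔ IsHookMap b h := by
  simp only [IsHookMap, FilledBlock.isHook_transpose]

theorem pairSign_swap {ι : Type*} [LinearOrder ι] (H : Finset ι) (x : ι → ℕ × ℕ) :
    pairSign H (fun i => (x i).swap) = pairSign H x := by
  simp only [pairSign, Prod.fst_swap, Prod.snd_swap]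
  congr 1
  exact prod_congr rfl fun i _ => prod_congr rfl fun j _ => mul_comm _ _

theorem sum_fragPairs {b : Fin k → FilledBlock} {h : Fin k → Fin k} (hbh : IsHookMap b h) :
    (fragPairs b h).sum = ∑ i, numPair (b i) := by
  change ∑ i ∈ hookSet b, fragPair b h i = _
  simp only [fragPair]
  exact sum_fiberwise_of_maps_to (fun i _ => mem_filter.2 ⟨mem_univ _, (hbh i).2.1⟩) _

/-- The fragment sums are sums over all blocks, so the parity is checked block by block; a block of
cardinality `m` contributes `(-1) ^ (1 + m)` to the sign factor. -/
theorem verticalCount_transpose_parity {b : Fin k → FilledBlock} {h : Fin k → Fin k}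
    {ρ : Fin k → ℕ} (hb : ∀ i, (b i).card = ρ i) (hbh : IsHookMap b h) :
    (-1 : ℤ) ^ (verticalCount (fun i => (b i).transpose) + ((fragPairs b h).map Prod.fst).sum) =
      (-1) ^ (k + ∑ i, ρ i) * (-1) ^ (verticalCount b + ((fragPairs b h).map Prod.snd).sum) := by
  have h1 : ((fragPairs b h).map Prod.fst).sum = ∑ i, (b i).pNum := by
    have := congrArg Prod.fst (sum_fragPairs hbh)
    rw [Prod.fst_sum] at this
    rw [← Multiset.fst_sum, this]
    rfl
  have h2 : ((fragPairs b h).map Prod.snd).sum = ∑ i, (b i).qNum := by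
    have := congrArg Prod.snd (sum_fragPairs hbh)
    rw [Prod.snd_sum] at this
    rw [← Multiset.snd_sum, this]
    rfl
  have h3 : k + ∑ i, ρ i = (∑ i : Fin k, 1) + ∑ i, ρ i := by simp
  rw [h1, h2, h3, verticalCount, verticalCount, card_filter, card_filter, ← sum_add_distrib,
    ← sum_add_distrib, ← sum_add_distrib, ← prod_pow_eq_pow_sum, ← prod_pow_eq_pow_sum,
    ← prod_pow_eq_pow_sum, ← prod_mul_distrib]
  refine prod_congr rfl fun i _ => ?_
  rw [← hb i, ← pow_add]
  cases b i with
  | hook p q =>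
    simp only [FilledBlock.transpose, FilledBlock.isVertical, FilledBlock.card, FilledBlock.pNum,
      FilledBlock.qNum, Bool.false_eq_true, if_false]
    rw [show 1 + (p + q + 1) + (0 + q) = (0 + p) + 2 * (q + 1) by ring, pow_add _ (0 + p), pow_mul]
    simp
  | horizontal m =>
    simp only [FilledBlock.transpose, FilledBlock.isVertical, FilledBlock.card, FilledBlock.pNum,
      FilledBlock.qNum, Bool.false_eq_true, if_false, if_true, add_zero]
  | vertical m =>
    simp only [FilledBlock.transpose, FilledBlock.isVertical, FilledBlock.card, FilledBlock.pNum,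
      FilledBlock.qNum, Bool.false_eq_true, if_false, if_true, add_zero]
    rw [show 1 + (m : ℕ) + (1 + m) = 2 * (1 + m) by ring, pow_mul]
    simp

/-- Transposing every block exchanges the `P`- and `Q`-numbers, preserves the product of
differences, and changes the remaining sign by a factor depending only on `ρ`. -/
theorem sum_sgn_transpose (μ : YoungDiagram) (ρ : Fin k → ℕ) :
    ∑ T ∈ filledStructures μ.transpose ρ, T.sgn =
      (-1) ^ (k + ∑ i, ρ i) * ∑ T ∈ filledStructures μ ρ, T.sgn := by
  rw [sum_sgn_eq_sum_codes, sum_sgn_eq_sum_codes, mul_sum]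
  have htr : ∀ b : Fin k → FilledBlock, (fun i => (b i).transpose.transpose) = b := fun b =>
    funext fun i => (b i).transpose_transpose
  symm
  refine sum_bij' (fun c _ => ((fun i => (c.1 i).transpose), c.2))
    (fun c _ => ((fun i => (c.1 i).transpose), c.2)) ?_ ?_ ?_ ?_ ?_
  · intro c hc
    rw [mem_codes] at hc ⊢
    exact ⟨fun i => by rw [FilledBlock.card_transpose, hc.1], isHookMap_transpose.2 hc.2⟩
  · intro c hc
    rw [mem_codes] at hc ⊢
    exact ⟨fun i => by rw [FilledBlock.card_transpose, hc.1], isHookMap_transpose.2 hc.2⟩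
  · intro c _
    exact Prod.ext (htr c.1) rfl
  · intro c _
    exact Prod.ext (htr c.1) rfl
  · rintro ⟨b, h⟩ hc
    rw [mem_codes] at hc
    have hpairs : fragPairs (fun i => (b i).transpose) h = (fragPairs b h).map Prod.swap := by
      rw [fragPairs, hookSet_transpose, fragPair_transpose, fragPairs, Multiset.map_map]
      rfl
    have hfst : ((fragPairs b h).map Prod.swap).map Prod.fst = (fragPairs b h).map Prod.snd := by
      rw [Multiset.map_map]
      rfl
    have hsnd : ((fragPairs b h).map Prod.swap).map Prod.snd = (fragPairs b h).map Prod.fst := by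
      rw [Multiset.map_map]
      rfl
    have hpar := verticalCount_transpose_parity hc.1 hc.2
    simp only [hpairs, hfst, hsnd, hookSet_transpose, fragPair_transpose, pairSign_swap,
      FrobeniusCoord.pCoords_transpose, FrobeniusCoord.qCoords_transpose]
    by_cases hcond : (fragPairs b h).map Prod.fst = FrobeniusCoord.pCoords μ ∧
        (fragPairs b h).map Prod.snd = FrobeniusCoord.qCoords μ
    · rw [if_pos hcond, if_pos hcond.symm]
      rw [pow_add, pow_add _ (verticalCount b)] at hpar
      linear_combination (-pairSign (hookSet b) (fragPair b h)) * hpar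
    · rw [if_neg hcond, if_neg fun h => hcond h.symm]
      simp

end FilledStructure

theorem theorem1p2p1 {n k : ℕ} (μ : YoungDiagram) (t : {c // c ∈ μ.cells} ≃ Fin n)
    (ρ : Fin k → ℕ) (g : Equiv.Perm (Fin n))
    (hg : g.partition.parts = (Finset.univ : Finset (Fin k)).val.map ρ) :
    SpechtChar.irrCharacter t g = ((∑ T ∈ filledStructures μ ρ, T.sgn : ℤ) : ℂ) := by
  have hμ := SpechtChar.card_eq_of_tableau t
  rw [SpechtChar.irrCharacter_eq_jacobiTrudi t _ g, SpechtChar.jacobiTrudi_eq_sum_sgn hμ hg]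
  -- The transposition symmetry is needed at every permutation, each with its own list of cycle
  -- lengths; there the factor from `sum_sgn_transpose` is the sign of the permutation.
  intro g'
  obtain ⟨k', ρ', hg'⟩ := SpechtChar.exists_parts_eq g'
  rw [SpechtChar.jacobiTrudi_eq_sum_sgn hμ hg',
    SpechtChar.jacobiTrudi_eq_sum_sgn (μ.card_transpose.trans hμ) hg',
    FilledStructure.sum_sgn_transpose, SpechtChar.sign_eq_of_parts_eq hg']
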